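/- Call $h:\mathbb R^d\to(0,\infty)$ \emph{uniformly strongly logarithmically concave} if $-\log h$ is differentiable with locally Lipschitz gradient and there are constants $0<\lambda\le\Lambda<\infty$ such that for almost every $x\in\mathbb R^d$ the Hessian of $-\log h$ at $x$ has its spectrum in $[\lambda,\Lambda]$. Let $f,g:\mathbb R^d\to(0,\infty)$ both be uniformly strongly logarithmically concave, with $\int_{\mathbb R^d} g=1$. Let $\mathcal H(q,p)=-\log\big(f(q)g(p)\big)$, and let $H_t:\mathbb R^d\times\mathbb R^d\to\mathbb R^d\times\mathbb R^d$ be the time-$t$ map $(q,p)\mapsto (Q,P)$ of the Hamiltonian system $\dot Q=\partial\mathcal H/\partial P$, $\dot P=-\partial\mathcal H/\partial Q$. Let $L^2$ be the space of measurable $h:\mathbb R^d\to\mathbb R$ with $\|h\|_2^2=\int |h|^2/f<\infty$, and put $$(T_t h)(q)=\int_{\mathbb R^d} h(Q)\,g(P)\,dp,\qquad (Q,P)=H_t(q,p).$$ Its adjoint $T_t^\dagger$ with respect to $\langle a,b\rangle=\int ab/f$ is given by the same formula with $H_t^{-1}$ in place of $H_t$; $T_t$ is called self-adjoint if $T_t^\dagger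 h=T_t h$ almost everywhere for every $h\in L^2$. Then $f$ is integrable, and there is $t_0>0$ such that for every $t\in(0,t_0)$ for which $T_t$ is self-adjoint there is $\rho\in(0,1)$ such that for every $h\in L^2$ and every integer $n\ge 0$: $h$ is integrable, $T_t^n h\in L^2$, the integral defining $T_t(T_t^n h)(q)$ converges absolutely for almost every $q$, and $$\Big\|T_t^n h-f\,\frac{\int h}{\int f}\Big\|_2\le\rho^n\,\|h\|_2 .$$ -/

import Mathlib

open MeasureTheory

namespace HMC

/-- Uniformly strongly logarithmically concave: `h` is positive, `-log h` is differentiable with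
locally Lipschitz gradient (so that the Hamiltonian motion makes sense and the Hessian exists almost
everywhere), and the spectrum of the Hessian of `-log h` lies, at almost every point, in one fixed
interval `[lam, Lam]` with `0 < lam` and `Lam < ∞`. The Hessian at `x` is the derivative of the
gradient, as an operator on `ℝ^d`. -/
def UniformlyStronglyLogConcave {d : ℕ} (h : EuclideanSpace ℝ (Fin d) → ℝ) : Prop :=
  (∀ x, 0 < h x) ∧
  Differentiable ℝ (fun x => -Real.log (h x)) ∧
  LocallyLipschitz (gradient (fun x => -Real.log (h x))) ∧
  ∃ lam Lam : ℝ, 0 < lam ∧ ∀ᵐ x : EuclideanSpace ℝ (Fin d),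
    DifferentiableAt ℝ (gradient (fun y => -Real.log (h y))) x ∧
    spectrum ℝ (fderiv ℝ (gradient (fun y => -Real.log (h y))) x) ⊆ Set.Icc lam Lam

/-- The Hamiltonian `-log (f(q) g(p))`. -/
noncomputable def hamiltonian {d : ℕ} (f g : EuclideanSpace ℝ (Fin d) → ℝ)
    (q p : EuclideanSpace ℝ (Fin d)) : ℝ :=
  -Real.log (f q * g p)

/-- `s ↦ γ s = (Q s, P s)` solves `Q' = ∂H/∂P`, `P' = -∂H/∂Q` for all times. -/
def IsHamiltonianTrajectory {d : ℕ} (f g : EuclideanSpace ℝ (Fin d) → ℝ)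
    (γ : ℝ → EuclideanSpace ℝ (Fin d) × EuclideanSpace ℝ (Fin d)) : Prop :=
  ∀ s : ℝ,
    HasDerivAt (fun r => (γ r).1)
      (gradient (fun p => hamiltonian f g (γ s).1 p) (γ s).2) s ∧
    HasDerivAt (fun r => (γ r).2)
      (-gradient (fun q => hamiltonian f g q (γ s).2) (γ s).1) s

/-- The Hamiltonian motion `H_t`: the position at time `t` of the trajectory that starts at `z` at
time `0`. For uniformly strongly log-concave `f` and `g` the vector field is globally Lipschitz, so
this trajectory exists and is unique. -/
noncomputable def hamiltonianFlow {d : ℕ} (f g : EuclideanSpace ℝ (Fin d) → ℝ) (t : ℝ)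
    (z : EuclideanSpace ℝ (Fin d) × EuclideanSpace ℝ (Fin d)) :
    EuclideanSpace ℝ (Fin d) × EuclideanSpace ℝ (Fin d) :=
  Classical.epsilon (fun γ => IsHamiltonianTrajectory f g γ ∧ γ 0 = z) t

/-- The operator `(T h)(q) = ∫ h(Q) g(P) dp`, where `(Q, P) = H(q, p)`. -/
noncomputable def hmcOperator {d : ℕ} (g : EuclideanSpace ℝ (Fin d) → ℝ)
    (H : EuclideanSpace ℝ (Fin d) × EuclideanSpace ℝ (Fin d) →
      EuclideanSpace ℝ (Fin d) × EuclideanSpace ℝ (Fin d))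
    (h : EuclideanSpace ℝ (Fin d) → ℝ) : EuclideanSpace ℝ (Fin d) → ℝ :=
  fun q => ∫ p : EuclideanSpace ℝ (Fin d), h (H (q, p)).1 * g (H (q, p)).2

/-- The measure `dq / f(q)`. The space `L²` consists of the functions `h` with
`MemLp h 2 (weight f)`, and its norm is `eLpNorm h 2 (weight f) = (∫ |h|² / f)^(1/2)`. -/
noncomputable def weight {d : ℕ} (f : EuclideanSpace ℝ (Fin d) → ℝ) :
    Measure (EuclideanSpace ℝ (Fin d)) :=
  volume.withDensity (fun q => ENNReal.ofReal (1 / f q))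

/-- Self-adjointness of the operator built from `H`: it agrees on `L²` with the operator built
from the inverse of `H`. -/
def IsSelfAdjointHMC {d : ℕ} (f g : EuclideanSpace ℝ (Fin d) → ℝ)
    (H : EuclideanSpace ℝ (Fin d) × EuclideanSpace ℝ (Fin d) →
      EuclideanSpace ℝ (Fin d) × EuclideanSpace ℝ (Fin d)) : Prop :=
  ∀ h : EuclideanSpace ℝ (Fin d) → ℝ, MemLp h 2 (weight f) →
    hmcOperator g (Function.invFun H) h =ᵐ[volume] hmcOperator g H h

end HMC

/-! Write `h = f u`. Energy conservation gives `f(Q) g(P) = f(q) g(p)`, so `T_t (f u) = f · A u`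
with the Markov operator `(A u)(q) = ∫ u(Q) g(p) dp` (`hmcOperator_mul`), and `u ↦ f u` is an
isometry from `L²(f dq)` onto `L²(dq / f)`. By Liouville's theorem and energy conservation `f dq` is
invariant under `A`, and self-adjointness of `T_t` says that `A` is symmetric. What is needed is a
spectral gap for `A` on functions of mean zero.

The gap comes from Harris' theorem, with two inputs valid for short times. Drift
(`IsFlow.exists_drift`): far from the origin the force is of size at least `m ‖q‖` up to a constant,
so after time `t` the momentum is of order `t ‖q‖`; this kinetic energy has been taken from the
potential energy, which therefore serves as Lyapunov function. Minorization
(`IsFlow.exists_minorization`): `p ↦ Q` is strongly monotone and Lipschitz, hence onto, so the laws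
of `Q` for bounded `q` all dominate one multiple of the uniform measure on the unit ball.

Harris' theorem contracts a weighted oscillation seminorm by some `κ < 1`
(`exists_oscillation_contraction`), hence `‖A^n φ‖² ≤ C κ^n` for bounded centred `φ`, with `C`
depending on `φ`. Symmetry removes the constant: `n ↦ ‖A^n φ‖²` is log-convex, so its first ratio
cannot exceed its exponential rate, and `‖A φ‖² ≤ κ ‖φ‖²` (`le_mul_of_log_convex`). Density extends
this to all centred functions with `ρ = √κ`.

The gradients are only Lipschitz, so smooth tools are replaced. The almost everywhere Hessian bounds
are integrated along lines into strong monotonicity and Lipschitz bounds (`IsRegularPotential`);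
volume preservation passes to the limit from the symplectic Euler method, a composition of shears;
and Hausdorff measure takes the place of a Jacobian in the minorization. -/

namespace HMC

/-! ### Averaging operators and Harris' theorem -/

section Averaging

variable {X Y : Type*} [MeasurableSpace X] [MeasurableSpace Y]

/-- The Markov operator `φ ↦ (x ↦ ∫ φ (Q (x, y)) ∂μ y)`. -/
noncomputable def avg (Q : X × Y → X) (μ : Measure Y) (φ : X → ℝ) (x : X) : ℝ :=
  ∫ y, φ (Q (x, y)) ∂μ

lemma measurable_avg {Q : X × Y → X} (hQ : Measurable Q) {μ : Measure Y} [SFinite μ]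
    {φ : X → ℝ} (hφ : Measurable φ) : Measurable (avg Q μ φ) :=
  (StronglyMeasurable.integral_prod_right (f := fun x y => φ (Q (x, y)))
    (hφ.comp hQ).stronglyMeasurable).measurable

lemma abs_avg_le {X : Type*} {Q : X × Y → X} {μ : Measure Y} [IsProbabilityMeasure μ]
    {φ : X → ℝ} {M : ℝ} (hM : ∀ x, |φ x| ≤ M) (x : X) : |avg Q μ φ x| ≤ M := by
  have := norm_integral_le_of_norm_le_const (μ := μ) (f := fun y => φ (Q (x, y)))
    (Filter.Eventually.of_forall fun y => hM _)
  simpa [avg] using this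

/-- The constant is the infimum of `φ + w`. It turns an oscillation bound into a pointwise bound on
a shifted function. -/
lemma exists_shift_of_oscillation {X : Type*} {φ w : X → ℝ} (h : ∀ x y, φ x - φ y ≤ w x + w y) :
    ∃ c, ∀ x, |φ x - c| ≤ w x := by
  rcases isEmpty_or_nonempty X with hX | ⟨⟨x₀⟩⟩
  · exact ⟨0, fun x => (hX.false x).elim⟩
  have : Nonempty X := ⟨x₀⟩
  have hb : ∀ x, ∀ y, φ x - w x ≤ φ y + w y := fun x y => by linarith [h x y]
  have hbdd : BddBelow (Set.range fun y => φ y + w y) := by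
    refine ⟨φ x₀ - w x₀, ?_⟩
    rintro _ ⟨y, rfl⟩
    exact hb x₀ y
  refine ⟨⨅ y, (φ y + w y), fun x => abs_le.2 ⟨?_, ?_⟩⟩
  · linarith [ciInf_le hbdd x]
  · linarith [le_ciInf (hb x)]

/-- One step of Harris' theorem: a drift condition and a minorization condition make the averaging
operator contract a weighted oscillation seminorm. -/
theorem exists_oscillation_contraction {Q : X × Y → X} (hQ : Measurable Q) {μ : Measure Y}
    [IsProbabilityMeasure μ] {V : X → ℝ} (hV : Measurable V) (hV0 : ∀ x, 0 ≤ V x)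
    (hVint : ∀ x, Integrable (fun y => V (Q (x, y))) μ) {γ K R α : ℝ} (hγ0 : 0 ≤ γ) (hγ1 : γ < 1)
    (hK : 0 ≤ K) (drift : ∀ x, avg Q μ V x ≤ γ * V x + K) (hR : 2 * K < (1 - γ) * R)
    (hα : 0 < α) {ν : Measure X} [IsProbabilityMeasure ν]
    (minor : ∀ x, V x ≤ R → ENNReal.ofReal α • ν ≤ μ.map (fun y => Q (x, y))) :
    ∃ β κ : ℝ, 0 < β ∧ 0 < κ ∧ κ < 1 ∧ ∀ C : ℝ, 0 ≤ C → ∀ φ : X → ℝ, Measurable φ →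
      (∀ x y, |φ x - φ y| ≤ C * (2 + β * V x + β * V y)) →
      ∀ x y, |avg Q μ φ x - avg Q μ φ y| ≤ (κ * C) * (2 + β * V x + β * V y) := by
  -- Small enough that the drift constant costs `2 β K ≤ α`, half of the `2 α` gained from the
  -- minorization.
  set β : ℝ := α / (2 * K + 1) with hβdef
  have hβ : 0 < β := by positivity
  have hβK : 2 * (β * K) ≤ α := by
    rw [hβdef, div_mul_eq_mul_div, ← mul_div_assoc, div_le_iff₀ (by positivity)]
    nlinarith
  have hRpos : 0 < R := by
    by_contra hcon
    nlinarith [mul_nonneg (sub_nonneg.2 hγ1.le) (neg_nonneg.2 (not_lt.1 hcon))]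
  -- The contraction ratio that the drift alone gives when `V x + V y = R`; it is below `1` because
  -- `2 K < (1 - γ) R`.
  set κ₁ : ℝ := (2 + β * γ * R + 2 * β * K) / (2 + β * R) with hκ₁
  have hden : 0 < 2 + β * R := by positivity
  have hκ₁lt : κ₁ < 1 := by
    rw [hκ₁, div_lt_one hden]
    nlinarith
  have hκ₁pos : 0 < κ₁ := by positivity
  set κ : ℝ := max κ₁ (max γ (1 - α / 2)) with hκ
  have hκκ₁ : κ₁ ≤ κ := le_max_left _ _
  have hκγ : γ ≤ κ := (le_max_left _ _).trans (le_max_right _ _)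
  have hκα : 1 - α / 2 ≤ κ := (le_max_right _ _).trans (le_max_right _ _)
  have hκpos : 0 < κ := hκ₁pos.trans_le hκκ₁
  refine ⟨β, κ, hβ, hκpos, max_lt hκ₁lt (max_lt hγ1 (by linarith)), ?_⟩
  intro C hC φ hφ hosc x y
  set w : X → ℝ := fun x => C * (1 + β * V x) with hw
  obtain ⟨c, hc⟩ := exists_shift_of_oscillation (φ := φ) (w := w) (fun x y => by
    have := (abs_le.1 (hosc x y)).2
    simp only [hw]; linarith)
  have hwm : Measurable w := by fun_prop
  have hQx : ∀ x, Measurable fun y => Q (x, y) := fun x => hQ.comp measurable_prodMk_left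
  have hwint : ∀ x, Integrable (fun y => w (Q (x, y))) μ := fun x =>
    ((integrable_const _).add ((hVint x).const_mul β)).const_mul C
  have huint : ∀ x, Integrable (fun y => φ (Q (x, y)) - c) μ := fun x =>
    (hwint x).mono' ((hφ.sub_const c).comp (hQx x)).aestronglyMeasurable
      (Filter.Eventually.of_forall fun y => hc _)
  have hPw : ∀ x, ∫ y, w (Q (x, y)) ∂μ ≤ C * (1 + β * (γ * V x + K)) := by
    intro x
    have : ∫ y, w (Q (x, y)) ∂μ = C * (1 + β * avg Q μ V x) := by
      simp only [hw, avg]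
      rw [integral_const_mul, integral_add (integrable_const _) ((hVint x).const_mul β),
        integral_const_mul]
      simp
    rw [this]
    gcongr
    exact drift x
  have hPu : ∀ x, avg Q μ φ x = (∫ y, (φ (Q (x, y)) - c) ∂μ) + c := by
    intro x
    have h1 : Integrable (fun y => φ (Q (x, y))) μ := by
      exact ((huint x).add (integrable_const c)).congr
        (Filter.Eventually.of_forall fun y => by simp)
    rw [integral_sub h1 (integrable_const _)]
    simp [avg]
  have hsub : avg Q μ φ x - avg Q μ φ y =
      (∫ z, (φ (Q (x, z)) - c) ∂μ) - ∫ z, (φ (Q (y, z)) - c) ∂μ := by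
    rw [hPu x, hPu y]; ring
  rw [hsub]
  -- Far apart in this sense, the drift alone contracts. Otherwise both points lie in `{V ≤ R}` and
  -- their laws share the mass `α ν`.
  by_cases hxy : R ≤ V x + V y
  · have hb : ∀ x, |∫ z, (φ (Q (x, z)) - c) ∂μ| ≤ C * (1 + β * (γ * V x + K)) := fun x => by
      rw [← Real.norm_eq_abs]
      exact (norm_integral_le_of_norm_le (hwint x) (Filter.Eventually.of_forall fun y => hc _)).trans
        (hPw x)
    have h1 := abs_sub (∫ z, (φ (Q (x, z)) - c) ∂μ) (∫ z, (φ (Q (y, z)) - c) ∂μ)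
    have hkey : 2 + β * γ * (V x + V y) + 2 * β * K ≤ κ * (2 + β * (V x + V y)) := by
      have e1 : 2 + β * γ * R + 2 * β * K ≤ κ * (2 + β * R) := by
        rw [← div_le_iff₀ hden]; exact hκκ₁
      have e2 : γ * (β * (V x + V y - R)) ≤ κ * (β * (V x + V y - R)) :=
        mul_le_mul_of_nonneg_right hκγ (mul_nonneg hβ.le (by linarith))
      nlinarith
    have h2 := mul_le_mul_of_nonneg_left hkey hC
    have := hb x
    have := hb y
    nlinarith
  · push Not at hxy
    have hVx : V x ≤ R := by linarith [hV0 y]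
    have hVy : V y ≤ R := by linarith [hV0 x]
    have hwu0 : ∀ z, 0 ≤ w z := fun z => (abs_nonneg _).trans (hc z)
    -- The contribution of the shared part `α ν`, which cancels in the difference. The remainder is
    -- controlled by integrating the nonnegative functions `w ± (φ - c)` against `α ν` and against
    -- the larger law.
    set A : ℝ := α * ∫ z, (φ z - c) ∂ν with hA
    have hcmp : ∀ x, V x ≤ R → Integrable w ν ∧
        |(∫ z, (φ (Q (x, z)) - c) ∂μ) - A| ≤ (∫ z, w (Q (x, z)) ∂μ) - α * ∫ z, w z ∂ν := by
      intro x hx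
      have hle := minor x hx
      have hm := hQx x
      have hwi : Integrable w (μ.map fun y => Q (x, y)) :=
        (integrable_map_measure hwm.aestronglyMeasurable hm.aemeasurable).2 (hwint x)
      have hui : Integrable (fun z => φ z - c) (μ.map fun y => Q (x, y)) :=
        (integrable_map_measure (hφ.sub_const c).aestronglyMeasurable hm.aemeasurable).2 (huint x)
      have hα' : ENNReal.ofReal α ≠ 0 := by simpa using hα
      have hwν : Integrable w ν :=
        (integrable_smul_measure hα' ENNReal.ofReal_ne_top).1 (hwi.mono_measure hle)
      have huν : Integrable (fun z => φ z - c) ν :=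
        (integrable_smul_measure hα' ENNReal.ofReal_ne_top).1 (hui.mono_measure hle)
      have i1 := integral_mono_measure hle (f := fun z => w z - (φ z - c))
        (Filter.Eventually.of_forall fun z => sub_nonneg.2 (le_of_abs_le (hc z))) (hwi.sub hui)
      have i2 := integral_mono_measure hle (f := fun z => w z + (φ z - c))
        (Filter.Eventually.of_forall fun z => by
          have := neg_le_of_abs_le (hc z); simp only [Pi.zero_apply]; linarith) (hwi.add hui)
      rw [integral_smul_measure, integral_sub hwν huν, integral_sub hwi hui,
        ENNReal.toReal_ofReal hα.le, smul_eq_mul] at i1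
      rw [integral_smul_measure, integral_add hwν huν, integral_add hwi hui,
        ENNReal.toReal_ofReal hα.le, smul_eq_mul] at i2
      rw [integral_map hm.aemeasurable hwm.aestronglyMeasurable,
        integral_map hm.aemeasurable (hφ.sub_const c).aestronglyMeasurable] at i1 i2
      refine ⟨hwν, abs_le.2 ⟨?_, ?_⟩⟩ <;> simp only [hA] <;> linarith
    have hwν1 : C ≤ ∫ z, w z ∂ν := by
      have := integral_mono (μ := ν) (integrable_const C) (hcmp x hVx).1 (fun z => by
        simp only [hw]
        nlinarith [mul_nonneg hC (mul_nonneg hβ.le (hV0 z))])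
      simpa using this
    have h1 := (abs_le.1 (hcmp x hVx).2)
    have h2 := (abs_le.1 (hcmp y hVy).2)
    have hbd : |(∫ z, (φ (Q (x, z)) - c) ∂μ) - ∫ z, (φ (Q (y, z)) - c) ∂μ| ≤
        (∫ z, w (Q (x, z)) ∂μ) + (∫ z, w (Q (y, z)) ∂μ) - 2 * (α * ∫ z, w z ∂ν) := by
      refine abs_le.2 ⟨?_, ?_⟩ <;> linarith [h1.1, h1.2, h2.1, h2.2]
    refine hbd.trans ?_
    have h3 := hPw x
    have h4 := hPw y
    have h5 : α * C ≤ α * ∫ z, w z ∂ν := by gcongr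
    have hkey : 2 - 2 * α + β * γ * (V x + V y) + 2 * (β * K) ≤ κ * (2 + β * (V x + V y)) := by
      have e2 : γ * (β * (V x + V y)) ≤ κ * (β * (V x + V y)) :=
        mul_le_mul_of_nonneg_right hκγ (mul_nonneg hβ.le (by linarith [hV0 x, hV0 y]))
      nlinarith
    have h6 := mul_le_mul_of_nonneg_left hkey hC
    nlinarith

/-- Log-convexity makes the ratios `a (n + 1) / a n` nondecreasing, so a first ratio above `κ` would
force growth faster than `C κ ^ n`, whatever `C` is. -/
lemma le_mul_of_log_convex {a : ℕ → ℝ} {κ C : ℝ} (hκ : 0 < κ) (ha : ∀ n, 0 ≤ a n)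
    (hconv : ∀ n, a (n + 1) ^ 2 ≤ a n * a (n + 2)) (hC : ∀ n, a n ≤ C * κ ^ n) :
    a 1 ≤ κ * a 0 := by
  by_contra! hlt
  have ha1 : 0 < a 1 := (mul_nonneg hκ.le (ha 0)).trans_lt hlt
  have ha0 : 0 < a 0 := by
    rcases (ha 0).eq_or_lt with h | h
    · have := hconv 0
      rw [← h, zero_mul] at this
      nlinarith
    · exact h
  set r := a 1 / a 0 with hr
  have hκr : κ < r := by rwa [hr, lt_div_iff₀ ha0]
  have hr0 : 0 < r := hκ.trans hκr
  have key : ∀ n, 0 < a n ∧ r * a n ≤ a (n + 1) := by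
    intro n
    induction n with
    | zero => exact ⟨ha0, by rw [hr, div_mul_cancel₀ _ ha0.ne']⟩
    | succ n ih =>
      have hpos : 0 < a (n + 1) := (mul_pos hr0 ih.1).trans_le ih.2
      refine ⟨hpos, ?_⟩
      have h1 := hconv n
      have h2 : (r * a n) * a (n + 1) ≤ a n * a (n + 2) :=
        (mul_le_mul_of_nonneg_right ih.2 hpos.le).trans (by rw [← sq]; exact h1)
      have h3 : a n * (r * a (n + 1)) ≤ a n * a (n + 2) := by linarith
      exact le_of_mul_le_mul_left h3 ih.1
  have hgrow : ∀ n, r ^ n * a 0 ≤ a n := by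
    intro n
    induction n with
    | zero => simp
    | succ n ih =>
      calc r ^ (n + 1) * a 0 = r * (r ^ n * a 0) := by ring
        _ ≤ r * a n := by gcongr
        _ ≤ a (n + 1) := (key n).2
  have hb : ∀ n, (r / κ) ^ n ≤ C / a 0 := by
    intro n
    rw [div_pow, div_le_div_iff₀ (by positivity) ha0]
    exact (hgrow n).trans (hC n)
  obtain ⟨n, hn⟩ := pow_unbounded_of_one_lt (C / a 0) ((one_lt_div hκ).2 hκr)
  exact absurd (hb n) (not_le.2 hn)

/-! ### Averaging operators with an invariant measure: from oscillation to square mean. -/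

section Invariant

variable {Q : X × Y → X} {μ : Measure Y} [IsProbabilityMeasure μ] {π : Measure X}
  [IsFiniteMeasure π]

lemma integral_avg (hπ : MeasurePreserving Q (π.prod μ) π) {φ : X → ℝ} (hφ : Integrable φ π) :
    Integrable (avg Q μ φ) π ∧ (∀ᵐ x ∂π, Integrable (fun y => φ (Q (x, y))) μ) ∧
      ∫ x, avg Q μ φ x ∂π = ∫ x, φ x ∂π := by
  have h : Integrable (fun z => φ (Q z)) (π.prod μ) := hπ.integrable_comp_of_integrable hφ
  refine ⟨h.integral_prod_left, h.prod_right_ae, ?_⟩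
  unfold avg
  rw [← integral_prod (fun z => φ (Q z)) h]
  have := integral_map (μ := π.prod μ) (φ := Q) hπ.measurable.aemeasurable (f := φ)
    (by rw [hπ.map_eq]; exact hφ.1)
  rw [hπ.map_eq] at this
  exact this.symm

/-- Jensen's inequality in the averaging variable, then invariance of `π`. -/
lemma eLpNorm_avg_le (hπ : MeasurePreserving Q (π.prod μ) π) {φ : X → ℝ} (hφ : MemLp φ 2 π) :
    MemLp (avg Q μ φ) 2 π ∧ eLpNorm (avg Q μ φ) 2 π ≤ eLpNorm φ 2 π := by
  have hcomp : MemLp (fun z => φ (Q z)) 2 (π.prod μ) := hφ.comp_measurePreserving hπ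
  have hle : eLpNorm (avg Q μ φ) 2 π ≤ eLpNorm φ 2 π := by
    have h0 : eLpNorm φ 2 π = eLpNorm (fun z => φ (Q z)) 2 (π.prod μ) :=
      (eLpNorm_comp_measurePreserving hφ.1 hπ).symm
    rw [h0, eLpNorm_eq_lintegral_rpow_enorm_toReal (by simp) (by simp),
      eLpNorm_eq_lintegral_rpow_enorm_toReal (by simp) (by simp)]
    gcongr
    rw [lintegral_prod _ (hcomp.1.enorm.pow_const _)]
    refine lintegral_mono_ae ?_
    filter_upwards [hcomp.1.prodMk_left] with x hx
    have h1 : ‖avg Q μ φ x‖ₑ ≤ eLpNorm (fun y => φ (Q (x, y))) 2 μ :=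
      (enorm_integral_le_lintegral_enorm _).trans
        (by rw [← eLpNorm_one_eq_lintegral_enorm]
            exact eLpNorm_le_eLpNorm_of_exponent_le (by norm_num) hx)
    calc ‖avg Q μ φ x‖ₑ ^ (2 : ENNReal).toReal
        ≤ (eLpNorm (fun y => φ (Q (x, y))) 2 μ) ^ (2 : ENNReal).toReal := by gcongr
      _ = _ := by
        rw [eLpNorm_eq_lintegral_rpow_enorm_toReal (by simp) (by simp), ← ENNReal.rpow_mul]
        simp
  refine ⟨⟨(integral_avg hπ (hφ.integrable (by norm_num))).1.1, hle.trans_lt hφ.2⟩, hle⟩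

/-- Powers of an averaging operator applied to a bounded centred function decay geometrically in
the square mean. -/
lemma exists_integral_sq_iterate_le (hπ : MeasurePreserving Q (π.prod μ) π) {V : X → ℝ}
    (hV0 : ∀ x, 0 ≤ V x) (hVπ : Integrable V π)
    {β κ : ℝ} (hβ : 0 < β) (hκ : 0 < κ)
    (hosc : ∀ C : ℝ, 0 ≤ C → ∀ φ : X → ℝ, Measurable φ →
      (∀ x y, |φ x - φ y| ≤ C * (2 + β * V x + β * V y)) →
      ∀ x y, |avg Q μ φ x - avg Q μ φ y| ≤ (κ * C) * (2 + β * V x + β * V y))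
    {φ : X → ℝ} (hφ : Measurable φ) {M : ℝ} (hM : ∀ x, |φ x| ≤ M) (h0 : ∫ x, φ x ∂π = 0) :
    ∃ C, ∀ n, ∫ x, ((avg Q μ)^[n] φ x) ^ 2 ∂π ≤ C * κ ^ n := by
  rcases isEmpty_or_nonempty X with hX | ⟨⟨x₀⟩⟩
  · exact ⟨0, fun n => by simp [Measure.eq_zero_of_isEmpty π]⟩
  have hM0 : 0 ≤ M := (abs_nonneg _).trans (hM x₀)
  rcases eq_or_ne π 0 with rfl | hπ0
  · exact ⟨0, fun n => by simp⟩
  set Z := π.real Set.univ with hZ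
  have hZpos : 0 < Z := by
    rw [hZ, measureReal_def]
    exact ENNReal.toReal_pos (by simpa using hπ0) (measure_ne_top _ _)
  have hstep : ∀ n, Measurable ((avg Q μ)^[n] φ) ∧ (∀ x, |(avg Q μ)^[n] φ x| ≤ M) ∧
      (∫ x, (avg Q μ)^[n] φ x ∂π = 0) ∧
      ∀ x y, |(avg Q μ)^[n] φ x - (avg Q μ)^[n] φ y| ≤
        (κ ^ n * M) * (2 + β * V x + β * V y) := by
    intro n
    induction n with
    | zero =>
      refine ⟨hφ, hM, h0, fun x y => ?_⟩
      have h1 := abs_sub (φ x) (φ y)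
      have := mul_nonneg hM0 (add_nonneg (mul_nonneg hβ.le (hV0 x)) (mul_nonneg hβ.le (hV0 y)))
      simp only [Function.iterate_zero, id, pow_zero, one_mul]
      linarith [hM x, hM y]
    | succ n ih =>
      obtain ⟨i1, i2, i3, i4⟩ := ih
      rw [Function.iterate_succ_apply']
      refine ⟨measurable_avg hπ.measurable i1, abs_avg_le i2, ?_, fun x y => ?_⟩
      · have hi : Integrable ((avg Q μ)^[n] φ) π :=
          (integrable_const M).mono' i1.aestronglyMeasurable (Filter.Eventually.of_forall i2)
        rw [(integral_avg hπ hi).2.2, i3]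
      · have := hosc _ (by positivity) _ i1 i4 x y
        rwa [← mul_assoc, ← pow_succ'] at this
  set I := ∫ y, V y ∂π with hI
  refine ⟨M * (M / Z * (2 * Z * Z + β * I * Z + Z * (β * I))), fun n => ?_⟩
  obtain ⟨i1, i2, i3, i4⟩ := hstep n
  set ψ := (avg Q μ)^[n] φ with hψ
  have hψi : Integrable ψ π :=
    (integrable_const M).mono' i1.aestronglyMeasurable (Filter.Eventually.of_forall i2)
  -- Since `ψ` has mean zero, `ψ x · Z` is the integral over `y` of `ψ x - ψ y`, which the
  -- oscillation bound controls.
  have hpt : ∀ x, |ψ x| ≤ κ ^ n * (M / Z * ((2 + β * V x) * Z + β * I)) := by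
    intro x
    have e1 : ∫ y, (ψ x - ψ y) ∂π = ψ x * Z := by
      rw [integral_sub (integrable_const _) hψi, i3]
      simp [hZ, mul_comm]
    have hint : Integrable (fun y => (κ ^ n * M) * (2 + β * V x + β * V y)) π :=
      ((integrable_const _).add (hVπ.const_mul β)).const_mul _
    have e2 : ∫ y, (κ ^ n * M) * (2 + β * V x + β * V y) ∂π =
        (κ ^ n * M) * ((2 + β * V x) * Z + β * I) := by
      rw [integral_const_mul, integral_add (integrable_const _) (hVπ.const_mul β),
        integral_const_mul]
      simp [hZ, hI, mul_comm]
    have e3 := norm_integral_le_of_norm_le (f := fun y => ψ x - ψ y) hint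
      (Filter.Eventually.of_forall fun y => i4 x y)
    rw [e1, e2, Real.norm_eq_abs, abs_mul, abs_of_pos hZpos, ← le_div_iff₀ hZpos] at e3
    refine e3.trans (le_of_eq ?_)
    ring
  have hmaj : Integrable (fun x => M * (κ ^ n * (M / Z * ((2 + β * V x) * Z + β * I)))) π :=
    ((((((integrable_const _).add (hVπ.const_mul β)).mul_const Z).add
      (integrable_const _)).const_mul _).const_mul _).const_mul _
  -- One factor of `ψ ^ 2` is bounded by `M` and only the other by the decaying bound, so that `V`
  -- need only be integrable, not square integrable.
  calc ∫ x, ψ x ^ 2 ∂π ≤ ∫ x, M * (κ ^ n * (M / Z * ((2 + β * V x) * Z + β * I))) ∂π := by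
        refine integral_mono_of_nonneg (Filter.Eventually.of_forall fun x => sq_nonneg _) hmaj
          (Filter.Eventually.of_forall fun x => ?_)
        simp only
        rw [← sq_abs, sq]
        exact mul_le_mul (i2 x) (hpt x) (abs_nonneg _) hM0
    _ = M * (M / Z * (2 * Z * Z + β * I * Z + Z * (β * I))) * κ ^ n := by
        have hlin : Integrable (fun x => 2 + β * V x) π :=
          (integrable_const _).add (hVπ.const_mul β)
        rw [integral_const_mul, integral_const_mul, integral_const_mul,
          integral_add (hlin.mul_const Z) (integrable_const _), integral_mul_const,
          integral_add (integrable_const _) (hVπ.const_mul β), integral_const_mul]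
        simp only [integral_const, smul_eq_mul, ← hZ, ← hI]
        ring

/-- Symmetry and Cauchy–Schwarz make the squared norms of the iterates log-convex. The constant in
their geometric decay then disappears and the rate `κ` already holds in the first step. -/
lemma integral_sq_avg_le (hπ : MeasurePreserving Q (π.prod μ) π)
    (hsymm : ∀ φ ψ : X → ℝ, Measurable φ → Measurable ψ → (∃ M, ∀ x, |φ x| ≤ M) →
      (∃ M, ∀ x, |ψ x| ≤ M) → ∫ x, avg Q μ φ x * ψ x ∂π = ∫ x, φ x * avg Q μ ψ x ∂π)
    {V : X → ℝ} (hV0 : ∀ x, 0 ≤ V x) (hVπ : Integrable V π)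
    {β κ : ℝ} (hβ : 0 < β) (hκ : 0 < κ)
    (hosc : ∀ C : ℝ, 0 ≤ C → ∀ φ : X → ℝ, Measurable φ →
      (∀ x y, |φ x - φ y| ≤ C * (2 + β * V x + β * V y)) →
      ∀ x y, |avg Q μ φ x - avg Q μ φ y| ≤ (κ * C) * (2 + β * V x + β * V y))
    {φ : X → ℝ} (hφ : Measurable φ) {M : ℝ} (hM : ∀ x, |φ x| ≤ M) (h0 : ∫ x, φ x ∂π = 0) :
    ∫ x, (avg Q μ φ x) ^ 2 ∂π ≤ κ * ∫ x, φ x ^ 2 ∂π := by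
  obtain ⟨C, hC⟩ := exists_integral_sq_iterate_le hπ hV0 hVπ hβ hκ hosc hφ hM h0
  have hmb : ∀ n, Measurable ((avg Q μ)^[n] φ) ∧ ∀ x, |(avg Q μ)^[n] φ x| ≤ M := by
    intro n
    induction n with
    | zero => exact ⟨hφ, hM⟩
    | succ n ih =>
      rw [Function.iterate_succ_apply']
      exact ⟨measurable_avg hπ.measurable ih.1, abs_avg_le ih.2⟩
  have hL2 : ∀ n, MemLp ((avg Q μ)^[n] φ) 2 π := fun n =>
    MemLp.of_bound (hmb n).1.aestronglyMeasurable M (Filter.Eventually.of_forall (hmb n).2)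
  refine le_mul_of_log_convex (a := fun n => ∫ x, ((avg Q μ)^[n] φ x) ^ 2 ∂π) hκ
    (fun n => integral_nonneg fun x => sq_nonneg _) (fun n => ?_) hC
  have e : ∫ x, ((avg Q μ)^[n + 1] φ x) ^ 2 ∂π =
      ∫ x, (avg Q μ)^[n] φ x * (avg Q μ)^[n + 2] φ x ∂π := by
    have := hsymm ((avg Q μ)^[n] φ) ((avg Q μ)^[n + 1] φ) (hmb n).1 (hmb (n + 1)).1
      ⟨M, (hmb n).2⟩ ⟨M, (hmb (n + 1)).2⟩
    rw [← Function.iterate_succ_apply' (avg Q μ) n, ← Function.iterate_succ_apply' (avg Q μ)] at this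
    rw [← this]
    exact integral_congr_ae (Filter.Eventually.of_forall fun x => sq _)
  rw [e]
  set u := (avg Q μ)^[n] φ
  set v := (avg Q μ)^[n + 2] φ
  have hu : Integrable (fun x => u x ^ 2) π := (hL2 n).integrable_sq
  have hv : Integrable (fun x => v x ^ 2) π := (hL2 (n + 2)).integrable_sq
  have huv : Integrable (fun x => u x * v x) π := (hL2 n).integrable_mul (hL2 (n + 2))
  -- Cauchy–Schwarz, read off from the discriminant of `s ↦ ∫ (u + s v)²`.
  have hquad : ∀ s : ℝ, 0 ≤ (∫ x, v x ^ 2 ∂π) * (s * s) + (2 * ∫ x, u x * v x ∂π) * s +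
      ∫ x, u x ^ 2 ∂π := by
    intro s
    have : ∫ x, (u x + s * v x) ^ 2 ∂π = (∫ x, v x ^ 2 ∂π) * (s * s) +
        (2 * ∫ x, u x * v x ∂π) * s + ∫ x, u x ^ 2 ∂π := by
      have : ∀ x, (u x + s * v x) ^ 2 = (s * s) * v x ^ 2 + (2 * s) * (u x * v x) + u x ^ 2 :=
        fun x => by ring
      simp_rw [this]
      have hlin : Integrable (fun x => (s * s) * v x ^ 2 + (2 * s) * (u x * v x)) π :=
        (hv.const_mul _).add (huv.const_mul _)
      rw [integral_add hlin hu,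
        integral_add (hv.const_mul _) (huv.const_mul _), integral_const_mul, integral_const_mul]
      ring
    rw [← this]
    exact integral_nonneg fun x => sq_nonneg _
  have := discrim_le_zero hquad
  rw [discrim] at this
  nlinarith

/-- Projection onto the constants does not increase the norm; this is Hölder's inequality on a
finite measure. -/
lemma eLpNorm_mean_le {φ : X → ℝ} (hφ : MemLp φ 2 π) :
    eLpNorm (fun _ : X => (∫ x, φ x ∂π) / π.real Set.univ) 2 π ≤ eLpNorm φ 2 π := by
  rcases eq_or_ne π 0 with rfl | hπ0
  · simp
  have hne : π Set.univ ≠ 0 := by simpa using hπ0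
  have htop : π Set.univ ≠ ⊤ := measure_ne_top _ _
  have h1 : ‖(∫ x, φ x ∂π) / π.real Set.univ‖ₑ ≤
      eLpNorm φ 2 π * π Set.univ ^ (-(1 / 2 : ℝ)) := by
    rw [div_eq_mul_inv, enorm_mul, enorm_inv (by rw [measureReal_def]; exact
      (ENNReal.toReal_pos hne htop).ne')]
    have h2 : ‖∫ x, φ x ∂π‖ₑ ≤ eLpNorm φ 2 π * π Set.univ ^ (1 / 2 : ℝ) := by
      refine (enorm_integral_le_lintegral_enorm _).trans ?_
      rw [← eLpNorm_one_eq_lintegral_enorm]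
      refine (eLpNorm_le_eLpNorm_mul_rpow_measure_univ (q := 2) (by norm_num) hφ.1).trans
        (le_of_eq ?_)
      norm_num
    have h3 : ‖π.real Set.univ‖ₑ = π Set.univ := by
      rw [Real.enorm_eq_ofReal measureReal_nonneg, measureReal_def, ENNReal.ofReal_toReal htop]
    rw [h3]
    calc _ ≤ (eLpNorm φ 2 π * π Set.univ ^ (1 / 2 : ℝ)) * (π Set.univ)⁻¹ := by gcongr
      _ = _ := by
        rw [mul_assoc, ← ENNReal.rpow_neg_one, ← ENNReal.rpow_add _ _ hne htop]
        norm_num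
  rw [eLpNorm_const _ (by simp) (by simpa using hπ0)]
  calc _ ≤ (eLpNorm φ 2 π * π Set.univ ^ (-(1 / 2 : ℝ))) * π Set.univ ^ (1 / (2 : ENNReal).toReal) := by
        gcongr
    _ = eLpNorm φ 2 π := by
        rw [mul_assoc, ← ENNReal.rpow_add _ _ hne htop]
        norm_num

/-- A reversible averaging operator that satisfies a drift and a minorization condition contracts
the centred square integrable functions. -/
theorem exists_eLpNorm_avg_sub_mean_le (hπ : MeasurePreserving Q (π.prod μ) π)
    (hsymm : ∀ φ ψ : X → ℝ, Measurable φ → Measurable ψ → (∃ M, ∀ x, |φ x| ≤ M) →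
      (∃ M, ∀ x, |ψ x| ≤ M) → ∫ x, avg Q μ φ x * ψ x ∂π = ∫ x, φ x * avg Q μ ψ x ∂π)
    {V : X → ℝ} (hV : Measurable V) (hV0 : ∀ x, 0 ≤ V x) (hVπ : Integrable V π)
    (hVint : ∀ x, Integrable (fun y => V (Q (x, y))) μ) {γ K : ℝ} (hγ0 : 0 ≤ γ) (hγ1 : γ < 1)
    (hK : 0 ≤ K) (drift : ∀ x, avg Q μ V x ≤ γ * V x + K)
    (minor : ∀ R : ℝ, ∃ α : ℝ, 0 < α ∧ ∃ ν : Measure X, IsProbabilityMeasure ν ∧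
      ∀ x, V x ≤ R → ENNReal.ofReal α • ν ≤ μ.map (fun y => Q (x, y))) :
    ∃ ρ : ℝ, 0 < ρ ∧ ρ < 1 ∧ ∀ φ : X → ℝ, MemLp φ 2 π →
      eLpNorm (fun x => avg Q μ φ x - (∫ x, φ x ∂π) / π.real Set.univ) 2 π ≤
        ENNReal.ofReal ρ * eLpNorm (fun x => φ x - (∫ x, φ x ∂π) / π.real Set.univ) 2 π := by
  -- Any level above `2 K / (1 - γ)` meets the requirement on `R` in Harris' theorem.
  obtain ⟨α, hα, ν, hν, hmin⟩ := minor (2 * K / (1 - γ) + 1)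
  obtain ⟨β, κ, hβ, hκ, hκ1, hosc⟩ := exists_oscillation_contraction hπ.measurable hV hV0 hVint
    hγ0 hγ1 hK drift (R := 2 * K / (1 - γ) + 1)
    (by
      have : 0 < 1 - γ := by linarith
      rw [mul_add, mul_div_cancel₀ _ this.ne']
      linarith) hα hmin
  have hsub_avg : ∀ φ : X → ℝ, Integrable φ π → ∀ c : ℝ,
      avg Q μ (fun x => φ x - c) =ᵐ[π] fun x => avg Q μ φ x - c := by
    intro φ hφ c
    filter_upwards [(integral_avg hπ hφ).2.1] with x hx
    unfold avg
    rw [integral_sub hx (integrable_const _)]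
    simp
  refine ⟨√κ, Real.sqrt_pos.2 hκ, by rw [Real.sqrt_lt' one_pos]; simpa using hκ1, ?_⟩
  have hbdd : ∀ φ : X → ℝ, Measurable φ → ∀ M, (∀ x, |φ x| ≤ M) → ∫ x, φ x ∂π = 0 →
      eLpNorm (avg Q μ φ) 2 π ≤ ENNReal.ofReal √κ * eLpNorm φ 2 π := by
    intro φ hφ M hM h0
    have h := integral_sq_avg_le hπ hsymm hV0 hVπ hβ hκ hosc hφ hM h0
    have hL : MemLp φ 2 π :=
      MemLp.of_bound hφ.aestronglyMeasurable M (Filter.Eventually.of_forall hM)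
    rw [MemLp.eLpNorm_eq_integral_rpow_norm (by simp) (by simp) hL,
      MemLp.eLpNorm_eq_integral_rpow_norm (by simp) (by simp) (eLpNorm_avg_le hπ hL).1,
      ← ENNReal.ofReal_mul (by positivity)]
    refine ENNReal.ofReal_le_ofReal ?_
    simp only [ENNReal.toReal_ofNat, Real.rpow_ofNat, Real.norm_eq_abs, sq_abs]
    rw [← one_div, ← Real.sqrt_eq_rpow, ← Real.sqrt_eq_rpow, ← Real.sqrt_mul hκ.le]
    exact Real.sqrt_le_sqrt h
  -- Approximation by recentred simple functions, which are bounded. Recentring at most doubles the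
  -- error `ε / 4`.
  have hcentred : ∀ φ : X → ℝ, MemLp φ 2 π → ∫ x, φ x ∂π = 0 →
      eLpNorm (avg Q μ φ) 2 π ≤ ENNReal.ofReal √κ * eLpNorm φ 2 π := by
    intro φ hφ h0
    have hκe : ENNReal.ofReal √κ ≤ 1 := by
      rw [ENNReal.ofReal_le_one, Real.sqrt_le_one]; exact hκ1.le
    refine ENNReal.le_of_forall_pos_le_add fun ε hε _ => ?_
    obtain ⟨s, hs, hsL⟩ := hφ.exists_simpleFunc_eLpNorm_sub_lt (by simp)
      (ε := ENNReal.ofReal (ε / 4)) (by simpa using hε)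
    set c := (∫ x, s x ∂π) / π.real Set.univ with hc
    set u : X → ℝ := fun x => s x - c with hu
    have hsi : Integrable s π := hsL.integrable (by norm_num)
    have hφi : Integrable φ π := hφ.integrable (by norm_num)
    have huL : MemLp u 2 π := hsL.sub (memLp_const c)
    have hui : Integrable u π := huL.integrable (by norm_num)
    have hu0 : ∫ x, u x ∂π = 0 := by
      rcases eq_or_ne π 0 with rfl | hπ0
      · simp
      have hne : π.real Set.univ ≠ 0 := by
        rw [measureReal_def]
        exact (ENNReal.toReal_pos (by simpa using hπ0) (measure_ne_top _ _)).ne'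
      rw [hu, integral_sub hsi (integrable_const _), integral_const, hc, smul_eq_mul]
      field_simp
      ring
    obtain ⟨M, hM⟩ := s.exists_forall_norm_le
    have hub := hbdd u (s.measurable.sub_const c) (M + |c|)
      (fun x => (abs_sub _ _).trans (by have := hM x; rw [Real.norm_eq_abs] at this; linarith)) hu0
    have hclose : eLpNorm (fun x => φ x - u x) 2 π ≤ ENNReal.ofReal (ε / 2) := by
      have e1 : (fun x => φ x - u x) = (φ - ⇑s) + fun _ => c := by
        ext x; simp [hu]; ring
      -- As `φ` has mean zero, `c` is the mean of `s - φ`.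
      have e2 : eLpNorm (fun _ : X => c) 2 π ≤ eLpNorm (φ - ⇑s) 2 π := by
        have := eLpNorm_mean_le (hsL.sub hφ)
        have hi : ∫ x, (⇑s - φ) x ∂π = ∫ x, s x ∂π := by
          simp only [Pi.sub_apply]
          rw [integral_sub hsi hφi, h0, sub_zero]
        rw [hi, ← hc] at this
        rwa [eLpNorm_sub_comm] at this
      rw [e1]
      refine (eLpNorm_add_le (hφ.sub hsL).1 aestronglyMeasurable_const (by norm_num)).trans ?_
      rw [show (ε : ℝ) / 2 = ε / 4 + ε / 4 by ring, ENNReal.ofReal_add (by positivity) (by positivity)]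
      exact add_le_add hs.le (e2.trans hs.le)
    have hae : avg Q μ φ =ᵐ[π] avg Q μ (fun x => φ x - u x) + avg Q μ u := by
      filter_upwards [(integral_avg hπ hφi).2.1, (integral_avg hπ hui).2.1] with x h1 h2
      simp only [Pi.add_apply]
      unfold avg
      rw [integral_sub h1 h2]; ring
    have hd := eLpNorm_avg_le hπ (hφ.sub huL)
    calc eLpNorm (avg Q μ φ) 2 π
        = eLpNorm (avg Q μ (fun x => φ x - u x) + avg Q μ u) 2 π := eLpNorm_congr_ae hae
      _ ≤ eLpNorm (avg Q μ (fun x => φ x - u x)) 2 π + eLpNorm (avg Q μ u) 2 π :=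
          eLpNorm_add_le hd.1.1 (eLpNorm_avg_le hπ huL).1.1 (by norm_num)
      _ ≤ ENNReal.ofReal (ε / 2) + ENNReal.ofReal √κ * (eLpNorm φ 2 π + ENNReal.ofReal (ε / 2)) := by
          gcongr
          · exact hd.2.trans hclose
          · refine hub.trans ?_
            gcongr
            have e1 : u = φ - fun x => φ x - u x := by ext x; simp
            calc eLpNorm u 2 π = eLpNorm (φ - fun x => φ x - u x) 2 π := by rw [← e1]
              _ ≤ eLpNorm φ 2 π + eLpNorm (fun x => φ x - u x) 2 π :=
                eLpNorm_sub_le hφ.1 (hφ.sub huL).1 (by norm_num)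
              _ ≤ _ := by gcongr
      _ ≤ ENNReal.ofReal (ε / 2) + (ENNReal.ofReal √κ * eLpNorm φ 2 π + 1 * ENNReal.ofReal (ε / 2)) := by
          rw [mul_add]; gcongr
      _ = ENNReal.ofReal √κ * eLpNorm φ 2 π + ε := by
          rw [one_mul, add_comm, add_assoc, ← ENNReal.ofReal_add (by positivity) (by positivity),
            add_halves, ENNReal.ofReal_coe_nnreal]
  intro φ hφ
  have hφi : Integrable φ π := hφ.integrable (by norm_num)
  set c := (∫ x, φ x ∂π) / π.real Set.univ with hc
  rw [← eLpNorm_congr_ae (hsub_avg φ hφi c)]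
  refine hcentred _ (hφ.sub (memLp_const c)) ?_
  rcases eq_or_ne π 0 with rfl | hπ0
  · simp
  have hne : π.real Set.univ ≠ 0 := by
    rw [measureReal_def]
    exact (ENNReal.toReal_pos (by simpa using hπ0) (measure_ne_top _ _)).ne'
  rw [integral_sub hφi (integrable_const _), integral_const, hc, smul_eq_mul]
  field_simp
  ring

end Invariant
end Averaging
end HMC

namespace HMC

/-! ### Regular potentials -/

section Potential

variable {E : Type*} [NormedAddCommGroup E] [InnerProductSpace ℝ E] [FiniteDimensional ℝ E]

/-- A differentiable function with `L`-Lipschitz and `m`-strongly monotone gradient, `m > 0`. -/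
structure IsRegularPotential (F : E → ℝ) (m L : ℝ) : Prop where
  pos : 0 < m
  nonneg : 0 ≤ L
  hasGradientAt : ∀ x, HasGradientAt F (gradient F x) x
  mono : ∀ x y, m * ‖x - y‖ ^ 2 ≤ inner ℝ (gradient F x - gradient F y) (x - y)
  lip : ∀ x y, ‖gradient F x - gradient F y‖ ≤ L * ‖x - y‖

/-- Both bounds are read off coordinatewise in an orthonormal basis of eigenvectors, whose
eigenvalues lie in the spectrum. -/
lemma spectral_bounds {T : E →L[ℝ] E} (hT : (T : E →ₗ[ℝ] E).IsSymmetric) {m L : ℝ}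
    (hm : 0 < m) (hL : 0 ≤ L) (hs : spectrum ℝ T ⊆ Set.Icc m L) (v : E) :
    m * ‖v‖ ^ 2 ≤ inner ℝ (T v) v ∧ ‖T v‖ ≤ L * ‖v‖ := by
  set b := hT.eigenvectorBasis rfl with hb
  set ev := hT.eigenvalues rfl with hev
  have happ : ∀ i, T (b i) = ev i • b i := fun i => hT.apply_eigenvectorBasis rfl i
  have hmem : ∀ i, ev i ∈ Set.Icc m L := by
    intro i
    refine hs ?_
    rw [spectrum.mem_iff]
    rintro ⟨u, hu⟩
    have h0 : (u : E →L[ℝ] E) (b i) = 0 := by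
      rw [hu]
      simp [happ, Algebra.algebraMap_eq_smul_one]
    have h1 : ((↑u⁻¹ : E →L[ℝ] E) * (u : E →L[ℝ] E)) (b i) = b i := by
      rw [Units.inv_mul]; rfl
    rw [mul_apply_eq_comp, h0, map_zero] at h1
    exact b.orthonormal.ne_zero i h1.symm
  have hinner : ∀ i, inner ℝ (T v) (b i) = ev i * inner ℝ v (b i) := by
    intro i
    have : inner ℝ (T v) (b i) = inner ℝ v (T (b i)) := hT v (b i)
    rw [this, happ, inner_smul_right]
  have hvv : ‖v‖ ^ 2 = ∑ i, (inner ℝ v (b i)) ^ 2 := by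
    rw [← real_inner_self_eq_norm_sq, ← b.sum_inner_mul_inner]
    refine Finset.sum_congr rfl fun i _ => ?_
    rw [real_inner_comm v (b i), sq]
  constructor
  · rw [← b.sum_inner_mul_inner (T v) v, hvv, Finset.mul_sum]
    refine Finset.sum_le_sum fun i _ => ?_
    rw [hinner, real_inner_comm v (b i), mul_assoc, ← sq]
    exact mul_le_mul_of_nonneg_right (hmem i).1 (sq_nonneg _)
  · refine le_of_sq_le_sq ?_ (by positivity)
    rw [mul_pow, hvv, ← real_inner_self_eq_norm_sq, ← b.sum_inner_mul_inner, Finset.mul_sum]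
    refine Finset.sum_le_sum fun i _ => ?_
    rw [real_inner_comm (T v) (b i), hinner, ← sq, mul_pow]
    have := hmem i
    exact mul_le_mul_of_nonneg_right (pow_le_pow_left₀ (hm.le.trans this.1) this.2 2)
      (sq_nonneg _)

/-- Symmetry of the second derivative holds at every point where the first derivative is
differentiable, without continuity of the Hessian. `J` turns gradients into Fréchet derivatives. -/
lemma isSymmetric_fderiv_gradient {F : E → ℝ} (hF : Differentiable ℝ F) {x : E}
    (hx : DifferentiableAt ℝ (gradient F) x) :
    (fderiv ℝ (gradient F) x : E →ₗ[ℝ] E).IsSymmetric := by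
  let J : E →L[ℝ] (E →L[ℝ] ℝ) := LinearMap.toContinuousLinearMap
    { toFun := fun u => innerSL ℝ u
      map_add' := fun u v => by simp
      map_smul' := fun c u => by ext; simp }
  have hJ : ∀ u w, J u w = inner ℝ u w := fun u w => rfl
  have h1 : ∀ y, HasFDerivAt F (J (gradient F y)) y := fun y => by
    have := (hF y).hasGradientAt.hasFDerivAt
    exact this
  have h2 : HasFDerivAt (fun y => J (gradient F y)) (J.comp (fderiv ℝ (gradient F) x)) x :=
    J.hasFDerivAt.comp x hx.hasFDerivAt
  intro v w
  have := second_derivative_symmetric h1 h2 v w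
  simp only [ContinuousLinearMap.comp_apply, hJ] at this
  simp only [ContinuousLinearMap.coe_coe]
  rw [this, real_inner_comm]

/-- Fubini: each translate of a null set is null, and the two quantifiers can be exchanged. -/
lemma ae_ae_line [MeasurableSpace E] [BorelSpace E] {p : E → Prop} (h : ∀ᵐ x : E, p x) (v : E) :
    ∀ᵐ x : E, ∀ᵐ t : ℝ, p (x + t • v) := by
  obtain ⟨N, hN, hNm, hN0⟩ := exists_measurable_superset_of_null (ae_iff.1 h)
  have hm : MeasurableSet {z : E × ℝ | z.1 + z.2 • v ∉ N} :=
    (measurable_fst.add (measurable_snd.smul_const v)) hNm.compl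
  have h1 : ∀ᵐ t : ℝ, ∀ᵐ x : E, x + t • v ∉ N := by
    refine Filter.Eventually.of_forall fun t => ?_
    have : Filter.Tendsto (fun x : E => x + t • v) (ae volume) (ae volume) :=
      (measurePreserving_add_right volume (t • v)).quasiMeasurePreserving.tendsto_ae
    exact this (measure_eq_zero_iff_ae_notMem.1 hN0)
  have h2 := (Measure.ae_ae_comm (p := fun (x : E) (t : ℝ) => x + t • v ∉ N) hm).2 h1
  filter_upwards [h2] with x hx
  filter_upwards [hx] with t ht
  by_contra hc
  exact ht (hN hc)

/-- A locally Lipschitz gradient is absolutely continuous along the segment, so its increment is the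
integral of the Hessian. Pairing with `v` gives monotonicity; pairing with the increment itself
gives the norm bound. -/
lemma gradient_increment_of_ae_line {F : E → ℝ} (hlip : LocallyLipschitz (gradient F)) {x v : E}
    {m L : ℝ} (hx : ∀ᵐ t : ℝ, DifferentiableAt ℝ (gradient F) (x + t • v) ∧
      m * ‖v‖ ^ 2 ≤ inner ℝ (fderiv ℝ (gradient F) (x + t • v) v) v ∧
      ‖fderiv ℝ (gradient F) (x + t • v) v‖ ≤ L * ‖v‖) :
    m * ‖v‖ ^ 2 ≤ inner ℝ (gradient F (x + v) - gradient F x) v ∧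
      ‖gradient F (x + v) - gradient F x‖ ≤ L * ‖v‖ := by
  have hline : LocallyLipschitz fun t : ℝ => gradient F (x + t • v) := by
    refine hlip.comp ?_
    exact ContDiff.locallyLipschitz (𝕂 := ℝ) (by fun_prop)
  obtain ⟨K, hK⟩ := (hline.locallyLipschitzOn (s := Set.uIcc (0 : ℝ) 1)
    ).exists_lipschitzOnWith_of_compact isCompact_uIcc
  have hFTC : ∀ w : E, ∃ D : ℝ → ℝ, IntervalIntegrable D volume 0 1 ∧
      (∀ᵐ t : ℝ, D t = inner ℝ (fderiv ℝ (gradient F) (x + t • v) v) w) ∧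
      ∫ t in (0 : ℝ)..1, D t = inner ℝ (gradient F (x + v) - gradient F x) w := by
    intro w
    have hLw : LipschitzOnWith (‖innerSL ℝ w‖₊ * K)
        (fun t : ℝ => innerSL ℝ w (gradient F (x + t • v))) (Set.uIcc 0 1) :=
      (innerSL ℝ w).lipschitz.comp_lipschitzOnWith hK
    have hac := hLw.absolutelyContinuousOnInterval
    refine ⟨deriv fun t : ℝ => innerSL ℝ w (gradient F (x + t • v)), hac.intervalIntegrable_deriv,
      ?_, ?_⟩
    · filter_upwards [hx] with t ht
      have h1 : HasDerivAt (fun t : ℝ => x + t • v) v t := by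
        simpa using ((hasDerivAt_id t).smul_const v).const_add x
      have h2 := ht.1.hasFDerivAt.comp_hasDerivAt t h1
      have h3 := (innerSL ℝ w).hasFDerivAt.comp_hasDerivAt t h2
      have := h3.deriv
      simp only [Function.comp_def] at this
      rw [this, innerSL_apply_apply, real_inner_comm]
    · rw [hac.integral_deriv_eq_sub]
      simp only [innerSL_apply_apply, one_smul, zero_smul, add_zero]
      rw [← inner_sub_right, real_inner_comm]
  constructor
  · obtain ⟨D, hD, hDae, hDint⟩ := hFTC v
    rw [← hDint]
    have := intervalIntegral.integral_mono_ae (μ := volume) (a := 0) (b := 1)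
      (f := fun _ => m * ‖v‖ ^ 2) (g := D) (by norm_num) (by simp) hD
      (by filter_upwards [hx, hDae] with t h1 h2; rw [h2]; exact h1.2.1)
    simpa using this
  · set w := gradient F (x + v) - gradient F x with hw
    obtain ⟨D, hD, hDae, hDint⟩ := hFTC w
    have := intervalIntegral.integral_mono_ae (μ := volume) (a := 0) (b := 1)
      (f := D) (g := fun _ => L * ‖v‖ * ‖w‖) (by norm_num) hD (by simp)
      (by
        filter_upwards [hx, hDae] with t h1 h2
        rw [h2]
        exact (real_inner_le_norm _ _).trans (mul_le_mul_of_nonneg_right h1.2.2 (norm_nonneg _)))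
    rw [hDint, real_inner_self_eq_norm_sq] at this
    simp only [intervalIntegral.integral_const, sub_zero, one_smul] at this
    -- If the increment vanishes one cannot divide by its norm; `0 ≤ L * ‖v‖` is then taken from any
    -- one point of the line.
    rcases (norm_nonneg w).eq_or_lt with h0 | h0
    · rw [← h0]
      obtain ⟨t, ht⟩ := hx.exists
      exact (norm_nonneg _).trans ht.2.2
    · rw [sq] at this
      exact le_of_mul_le_mul_right this h0

/-- For fixed `v` the increment bounds hold for almost every base point, by integration along lines
parallel to `v`. The set where they hold is closed and dense, hence everything. -/
theorem UniformlyStronglyLogConcave.exists_isRegularPotential {d : ℕ}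
    {h : EuclideanSpace ℝ (Fin d) → ℝ} (hh : UniformlyStronglyLogConcave h) :
    ∃ m L : ℝ, IsRegularPotential (fun x => -Real.log (h x)) m L := by
  obtain ⟨-, hdiff, hlip, m, L, hm, hae⟩ := hh
  set F : EuclideanSpace ℝ (Fin d) → ℝ := fun x => -Real.log (h x) with hF
  have hcont : Continuous (gradient F) := hlip.continuous
  -- In dimension zero the spectrum is empty and says nothing about the sign of `L`.
  have hL0 : 0 ≤ max L 0 := le_max_right _ _
  have hpt : ∀ v : EuclideanSpace ℝ (Fin d), ∀ᵐ x : EuclideanSpace ℝ (Fin d), m * ‖v‖ ^ 2 ≤ inner ℝ (gradient F (x + v) - gradient F x) v ∧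
      ‖gradient F (x + v) - gradient F x‖ ≤ max L 0 * ‖v‖ := by
    intro v
    filter_upwards [ae_ae_line hae v] with x hx
    refine gradient_increment_of_ae_line hlip ?_
    filter_upwards [hx] with t ht
    exact ⟨ht.1, spectral_bounds (isSymmetric_fderiv_gradient hdiff ht.1) hm hL0
      (ht.2.trans (Set.Icc_subset_Icc_right (le_max_left _ _))) v⟩
  have hall : ∀ v x : EuclideanSpace ℝ (Fin d), m * ‖v‖ ^ 2 ≤ inner ℝ (gradient F (x + v) - gradient F x) v ∧
      ‖gradient F (x + v) - gradient F x‖ ≤ max L 0 * ‖v‖ := by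
    intro v x
    have hcl : IsClosed {x : EuclideanSpace ℝ (Fin d) |
        m * ‖v‖ ^ 2 ≤ inner ℝ (gradient F (x + v) - gradient F x) v ∧
        ‖gradient F (x + v) - gradient F x‖ ≤ max L 0 * ‖v‖} := by
      rw [Set.ofPred_and]
      exact (isClosed_le (by fun_prop) (by fun_prop)).inter
        (isClosed_le (by fun_prop) (by fun_prop))
    have hd := Measure.dense_of_ae (hpt v)
    have := hd.closure_eq
    rw [hcl.closure_eq] at this
    have hx : x ∈ (Set.univ : Set (EuclideanSpace ℝ (Fin d))) := trivial
    rwa [← this] at hx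
  refine ⟨m, max L 0, hm, hL0, fun x => (hdiff x).hasGradientAt, fun x y => ?_, fun x y => ?_⟩
  · simpa using (hall (x - y) y).1
  · simpa using (hall (x - y) y).2

lemma IsRegularPotential.weaken {F : E → ℝ} {m L m' L' : ℝ} (h : IsRegularPotential F m L)
    (hm' : 0 < m') (hm : m' ≤ m) (hL : L ≤ L') : IsRegularPotential F m' L' where
  pos := hm'
  nonneg := h.nonneg.trans hL
  hasGradientAt := h.hasGradientAt
  mono x y := (mul_le_mul_of_nonneg_right hm (sq_nonneg _)).trans (h.mono x y)
  lip x y := (h.lip x y).trans (mul_le_mul_of_nonneg_right hL (norm_nonneg _))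

/-! ### Strong convexity and growth of regular potentials. -/

namespace IsRegularPotential

variable {F : E → ℝ} {m L : ℝ}

lemma lipschitzWith (h : IsRegularPotential F m L) :
    LipschitzWith L.toNNReal (gradient F) :=
  LipschitzWith.of_dist_le_mul fun x y => by
    rw [dist_eq_norm, dist_eq_norm, Real.coe_toNNReal _ h.nonneg]
    exact h.lip x y

lemma continuous (h : IsRegularPotential F m L) : Continuous F :=
  continuous_iff_continuousAt.2 fun x => (h.hasGradientAt x).hasFDerivAt.continuousAt

lemma hasDerivAt_line (h : IsRegularPotential F m L) (x v : E) (t : ℝ) :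
    HasDerivAt (fun t : ℝ => F (x + t • v)) (inner ℝ (gradient F (x + t • v)) v) t := by
  have h1 : HasDerivAt (fun t : ℝ => x + t • v) v t := by
    simpa using ((hasDerivAt_id t).smul_const v).const_add x
  exact (h.hasGradientAt _).hasFDerivAt.comp_hasDerivAt t h1

/-- Strong monotonicity says that, along the segment, `F` minus its tangent and minus the parabola
has nonnegative derivative. -/
lemma add_inner_add_le (h : IsRegularPotential F m L) (x y : E) :
    F x + inner ℝ (gradient F x) (y - x) + m / 2 * ‖y - x‖ ^ 2 ≤ F y := by
  set v := y - x with hv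
  let ψ : ℝ → ℝ := fun t => F (x + t • v) - t * inner ℝ (gradient F x) v - m / 2 * ‖v‖ ^ 2 * t ^ 2
  have hψ : ∀ t, HasDerivAt ψ (inner ℝ (gradient F (x + t • v)) v - inner ℝ (gradient F x) v -
      m * ‖v‖ ^ 2 * t) t := by
    intro t
    have := ((h.hasDerivAt_line x v t).sub
      ((hasDerivAt_id t).mul_const (inner ℝ (gradient F x) v))).sub
      (((hasDerivAt_id t).pow 2).const_mul (m / 2 * ‖v‖ ^ 2))
    refine this.congr_deriv ?_
    simp; ring
  have hmono : MonotoneOn ψ (Set.Icc 0 1) := by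
    refine monotoneOn_of_deriv_nonneg (convex_Icc _ _)
      (fun t _ => (hψ t).continuousAt.continuousWithinAt)
      (fun t _ => (hψ t).differentiableAt.differentiableWithinAt) fun t ht => ?_
    rw [interior_Icc] at ht
    rw [(hψ t).deriv]
    have h1 := h.mono (x + t • v) x
    rw [add_sub_cancel_left, norm_smul, inner_smul_right, inner_sub_left, Real.norm_eq_abs,
      abs_of_pos ht.1] at h1
    have h2 : t * (m * ‖v‖ ^ 2 * t) ≤
        t * (inner ℝ (gradient F (x + t • v)) v - inner ℝ (gradient F x) v) := by
      nlinarith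
    linarith [le_of_mul_le_mul_left h2 ht.1]
  have := hmono (Set.left_mem_Icc.2 zero_le_one) (Set.right_mem_Icc.2 zero_le_one) zero_le_one
  simp only [ψ, zero_smul, add_zero, one_smul, hv, add_sub_cancel] at this
  simp only [hv]
  linarith

lemma norm_gradient_le (h : IsRegularPotential F m L) (x : E) :
    ‖gradient F x‖ ≤ ‖gradient F 0‖ + L * ‖x‖ := by
  have h1 := h.lip x 0
  have h2 := norm_le_norm_add_norm_sub (gradient F 0) (gradient F x)
  rw [sub_zero] at h1
  rw [norm_sub_rev] at h2
  linarith [norm_sub_rev (gradient F 0) (gradient F x)]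

lemma le_norm_gradient (h : IsRegularPotential F m L) (x : E) :
    m * ‖x‖ - ‖gradient F 0‖ ≤ ‖gradient F x‖ := by
  have h1 := h.mono x 0
  rw [sub_zero] at h1
  have h2 := real_inner_le_norm (gradient F x - gradient F 0) x
  have h3 := norm_sub_le (gradient F x) (gradient F 0)
  rcases (norm_nonneg x).eq_or_lt with h0 | h0
  · rw [← h0]
    nlinarith [norm_nonneg (gradient F x), norm_nonneg (gradient F 0)]
  · have h4 : (m * ‖x‖) * ‖x‖ ≤ ‖gradient F x - gradient F 0‖ * ‖x‖ := by nlinarith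
    linarith [le_of_mul_le_mul_right h4 h0]

/-- Quadratic bounds from both sides. -/
lemma exists_quadratic_bounds (h : IsRegularPotential F m L) :
    ∃ C : ℝ, 0 ≤ C ∧ ∀ x, m / 4 * ‖x‖ ^ 2 - C ≤ F x ∧ F x ≤ C * (1 + ‖x‖ ^ 2) := by
  have hm := h.pos
  have hL := h.nonneg
  set a := ‖gradient F 0‖ with ha
  have ha0 : 0 ≤ a := norm_nonneg _
  refine ⟨|F 0| + a ^ 2 / m + a + L, by positivity, fun x => ⟨?_, ?_⟩⟩
  · have h1 := h.add_inner_add_le 0 x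
    rw [sub_zero] at h1
    have h2 := (abs_le.1 (abs_real_inner_le_norm (gradient F 0) x)).1
    rw [← ha] at h2
    -- Half of the quadratic term `m / 2 * ‖x‖ ^ 2` pays for the linear one, which leaves `m / 4`.
    have h3 : a * ‖x‖ ≤ a ^ 2 / m + m / 4 * ‖x‖ ^ 2 := by
      have e : a ^ 2 / m + m / 4 * ‖x‖ ^ 2 - a * ‖x‖ = (a - m / 2 * ‖x‖) ^ 2 / m := by
        field_simp; ring
      have : 0 ≤ (a - m / 2 * ‖x‖) ^ 2 / m := by positivity
      linarith
    linarith [neg_abs_le (F 0)]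
  -- Expanding at `x` and evaluating at `0` bounds `F x` from above by `F 0` and the gradient at
  -- `x`.
  · have h1 := h.add_inner_add_le x 0
    rw [zero_sub, norm_neg, inner_neg_right] at h1
    have h2 := real_inner_le_norm (gradient F x) x
    have h3 := mul_le_mul_of_nonneg_right (h.norm_gradient_le x) (norm_nonneg x)
    have h4 : 0 ≤ m / 2 * ‖x‖ ^ 2 := by positivity
    have h5 : a * ‖x‖ ≤ a * (1 + ‖x‖ ^ 2) := by
      gcongr; nlinarith [sq_nonneg (‖x‖ - 1)]
    have h6 : 0 ≤ (|F 0| + a ^ 2 / m) * ‖x‖ ^ 2 := by positivity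
    have h7 : 0 ≤ a ^ 2 / m := by positivity
    nlinarith [le_abs_self (F 0)]

end IsRegularPotential

/-! ### Gaussian tails of `exp (-F)`. -/

variable [MeasurableSpace E] [BorelSpace E]

lemma integrable_exp_neg_mul_sq_norm {b : ℝ} (hb : 0 < b) :
    Integrable (fun x : E => Real.exp (-b * ‖x‖ ^ 2)) := by
  have h := (GaussianFourier.integrable_cexp_neg_mul_sq_norm_add (V := E) (b := (b : ℂ))
    (by simpa using hb) 0 0).norm
  refine h.congr (Filter.Eventually.of_forall fun x => ?_)
  simp only [zero_mul, add_zero, inner_zero_left, Complex.ofReal_zero, Complex.norm_exp]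
  congr 1
  rw [← Complex.ofReal_neg, ← Complex.ofReal_pow, ← Complex.ofReal_mul, Complex.ofReal_re]

/-- One half of the Gaussian factor `exp (-m/4 ‖x‖²)` absorbs the polynomial, the other half is
integrable. -/
lemma IsRegularPotential.integrable_quadratic_mul_exp_neg {F : E → ℝ} {m L : ℝ}
    (h : IsRegularPotential F m L) :
    Integrable (fun x : E => (1 + ‖x‖ ^ 2) * Real.exp (-F x)) := by
  obtain ⟨C, hC, hb⟩ := h.exists_quadratic_bounds
  have hm := h.pos
  have hc := h.continuous
  refine ((integrable_exp_neg_mul_sq_norm (E := E) (b := m / 8) (by positivity)).const_mul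
    ((1 + 8 / m) * Real.exp C)).mono' (by fun_prop) (Filter.Eventually.of_forall fun x => ?_)
  rw [Real.norm_of_nonneg (by positivity)]
  have h1 : Real.exp (-F x) ≤ Real.exp C * (Real.exp (-(m / 8) * ‖x‖ ^ 2) *
      Real.exp (-(m / 8) * ‖x‖ ^ 2)) := by
    rw [← Real.exp_add, ← Real.exp_add]
    refine Real.exp_le_exp.2 ?_
    linarith [(hb x).1]
  have h2 : (1 + ‖x‖ ^ 2) * Real.exp (-(m / 8) * ‖x‖ ^ 2) ≤ 1 + 8 / m := by
    have h3 : m / 8 * ‖x‖ ^ 2 + 1 ≤ Real.exp (m / 8 * ‖x‖ ^ 2) := Real.add_one_le_exp _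
    have h4 : Real.exp (-(m / 8) * ‖x‖ ^ 2) = (Real.exp (m / 8 * ‖x‖ ^ 2))⁻¹ := by
      rw [← Real.exp_neg]; ring_nf
    rw [h4, ← div_eq_mul_inv, div_le_iff₀ (Real.exp_pos _)]
    calc 1 + ‖x‖ ^ 2 ≤ (1 + 8 / m) * (m / 8 * ‖x‖ ^ 2 + 1) := by
          have : (1 + 8 / m) * (m / 8 * ‖x‖ ^ 2 + 1) =
              (1 + ‖x‖ ^ 2) + (m / 8 * ‖x‖ ^ 2 + 8 / m) := by field_simp; ring
          rw [this]
          have : 0 ≤ m / 8 * ‖x‖ ^ 2 + 8 / m := by positivity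
          linarith
      _ ≤ _ := by gcongr
  calc (1 + ‖x‖ ^ 2) * Real.exp (-F x)
      ≤ (1 + ‖x‖ ^ 2) * (Real.exp C * (Real.exp (-(m / 8) * ‖x‖ ^ 2) *
        Real.exp (-(m / 8) * ‖x‖ ^ 2))) := by gcongr
    _ = ((1 + ‖x‖ ^ 2) * Real.exp (-(m / 8) * ‖x‖ ^ 2)) *
        (Real.exp C * Real.exp (-(m / 8) * ‖x‖ ^ 2)) := by ring
    _ ≤ (1 + 8 / m) * (Real.exp C * Real.exp (-(m / 8) * ‖x‖ ^ 2)) := by gcongr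
    _ = _ := by ring

end Potential
end HMC

namespace HMC

/-! ### Global flows of Lipschitz vector fields -/

section Flow

variable {X : Type*} [NormedAddCommGroup X] [NormedSpace ℝ X]

/-- `φ` is the global flow of the vector field `v`. -/
structure IsFlow (v : X → X) (φ : ℝ → X → X) : Prop where
  zero : ∀ x, φ 0 x = x
  hasDerivAt : ∀ x t, HasDerivAt (fun s => φ s x) (v (φ t x)) t

/-- `γ` solves the autonomous equation `γ' = v ∘ γ` on the set `s`. -/
def SolvesOn (v : X → X) (γ : ℝ → X) (s : Set ℝ) : Prop :=
  ∀ t ∈ s, HasDerivWithinAt γ (v (γ t)) s t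

lemma SolvesOn.comp_sub {v : X → X} {γ : ℝ → X} {a b : ℝ} (h : SolvesOn v γ (Set.Icc a b)) (c : ℝ) :
    SolvesOn v (fun t => γ (t - c)) (Set.Icc (a + c) (b + c)) := by
  intro t ht
  have hmaps : Set.MapsTo (fun t => t - c) (Set.Icc (a + c) (b + c)) (Set.Icc a b) := by
    intro s hs
    exact ⟨by linarith [hs.1], by linarith [hs.2]⟩
  have := (h (t - c) (hmaps ht)).scomp t
    (((hasDerivAt_id t).sub_const c).hasDerivWithinAt (s := Set.Icc (a + c) (b + c))) hmaps
  simpa [Function.comp_def] using this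

lemma SolvesOn.glue {v : X → X} {γ₁ γ₂ : ℝ → X} {a b c : ℝ} (hab : a ≤ b) (hbc : b ≤ c)
    (h₁ : SolvesOn v γ₁ (Set.Icc a b)) (h₂ : SolvesOn v γ₂ (Set.Icc b c)) (h : γ₁ b = γ₂ b) :
    SolvesOn v (fun t => if t ≤ b then γ₁ t else γ₂ t) (Set.Icc a c) := by
  set γ : ℝ → X := fun t => if t ≤ b then γ₁ t else γ₂ t with hγ
  have e₁ : ∀ t ≤ b, γ t = γ₁ t := fun t ht => by simp [hγ, ht]
  have e₂ : ∀ t, b ≤ t → γ t = γ₂ t := fun t ht => by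
    rcases ht.eq_or_lt with rfl | hlt
    · simp [hγ, h]
    · simp [hγ, not_le.2 hlt]
  have k₁ : ∀ t ∈ Set.Icc a b, HasDerivWithinAt γ (v (γ t)) (Set.Icc a b) t := fun t ht => by
    rw [e₁ t ht.2]
    exact (h₁ t ht).congr (fun s hs => e₁ s hs.2) (e₁ t ht.2)
  have k₂ : ∀ t ∈ Set.Icc b c, HasDerivWithinAt γ (v (γ t)) (Set.Icc b c) t := fun t ht => by
    rw [e₂ t ht.1]
    exact (h₂ t ht).congr (fun s hs => e₂ s hs.1) (e₂ t ht.1)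
  intro t ht
  rw [← Set.Icc_union_Icc_eq_Icc hab hbc]
  rcases lt_trichotomy t b with hlt | rfl | hgt
  · refine (k₁ t ⟨ht.1, hlt.le⟩).union ?_
    exact HasFDerivWithinAt.of_notMem_closure (by simp [not_le.2 hlt])
  · exact (k₁ t ⟨ht.1, le_rfl⟩).union (k₂ t ⟨le_rfl, ht.2⟩)
  · refine HasDerivWithinAt.union ?_ (k₂ t ⟨hgt.le, ht.2⟩)
    exact HasFDerivWithinAt.of_notMem_closure (by simp [not_le.2 hgt])

variable [CompleteSpace X]

/-- The existence time depends on `K` alone: on the ball of radius `‖v x‖ + 1` the speed is at most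
`‖v x‖ + K (‖v x‖ + 1) ≤ (K + 1) (‖v x‖ + 1)`. Uniformity in `x` is what allows continuation to all
times. -/
lemma exists_solvesOn_local {v : X → X} {K : NNReal} (hv : LipschitzWith K v) (x : X) :
    ∃ γ : ℝ → X, γ 0 = x ∧ SolvesOn v γ (Set.Icc (-(1 / ((K : ℝ) + 1))) (1 / ((K : ℝ) + 1))) := by
  set ε : ℝ := 1 / ((K : ℝ) + 1) with hε
  have hK : (0 : ℝ) < (K : ℝ) + 1 := by positivity
  have hε0 : 0 < ε := by positivity
  have hpl : IsPicardLindelof (fun _ => v) (tmin := -ε) (tmax := ε)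
      ⟨0, by linarith, hε0.le⟩ x (‖v x‖₊ + 1) 0 (‖v x‖₊ + K * (‖v x‖₊ + 1)) K := by
    refine IsPicardLindelof.of_time_independent (fun y hy => ?_) hv.lipschitzOnWith ?_
    · have h1 := hv.norm_sub_le y x
      rw [Metric.mem_closedBall, dist_eq_norm] at hy
      have h2 : ‖v y‖ ≤ ‖v x‖ + ‖v y - v x‖ := by
        simpa using norm_add_le (v x) (v y - v x)
      push_cast at hy ⊢
      have : (K : ℝ) * ‖y - x‖ ≤ K * (‖v x‖ + 1) := by gcongr
      linarith
    · simp only [sub_zero, zero_sub, neg_neg, max_self]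
      push_cast
      rw [hε, mul_one_div, div_le_iff₀ hK]
      nlinarith [norm_nonneg (v x), K.2]
  obtain ⟨γ, h0, h⟩ := hpl.exists_eq_forall_mem_Icc_hasDerivWithinAt₀
  exact ⟨γ, h0, h⟩

lemma exists_solvesOn {v : X → X} {K : NNReal} (hv : LipschitzWith K v) (x : X) (n : ℕ) :
    ∃ γ : ℝ → X, γ 0 = x ∧
      SolvesOn v γ (Set.Icc (-(n * (1 / ((K : ℝ) + 1)))) (n * (1 / ((K : ℝ) + 1)))) := by
  set ε : ℝ := 1 / ((K : ℝ) + 1) with hε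
  have hε0 : 0 < ε := by positivity
  induction n with
  | zero =>
    refine ⟨fun _ => x, rfl, fun t ht => ?_⟩
    simp only [Nat.cast_zero, zero_mul, neg_zero, Set.Icc_self] at ht ⊢
    rw [Set.mem_singleton_iff] at ht
    subst ht
    exact HasFDerivWithinAt.of_subsingleton Set.subsingleton_singleton
  | succ n ih =>
    obtain ⟨γ, h0, hγ⟩ := ih
    have hn : 0 ≤ n * ε := by positivity
    obtain ⟨γr, hr0, hr⟩ := exists_solvesOn_local hv (γ (n * ε))
    obtain ⟨γl, hl0, hl⟩ := exists_solvesOn_local hv (γ (-(n * ε)))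
    rw [← hε] at hr hl
    have hr' : SolvesOn v γr (Set.Icc 0 ε) := fun t ht =>
      (hr t ⟨by linarith [ht.1], ht.2⟩).mono (Set.Icc_subset_Icc_left (by linarith))
    have hl' : SolvesOn v γl (Set.Icc (-ε) 0) := fun t ht =>
      (hl t ⟨ht.1, by linarith [ht.2]⟩).mono (Set.Icc_subset_Icc_right (by linarith))
    have hr'' := hr'.comp_sub (n * ε)
    have hl'' := hl'.comp_sub (-(n * ε))
    rw [zero_add] at hr'' hl''
    have hg := hγ.glue (by linarith) (by linarith) hr'' (by simp [hr0])
    have hg2 := hl''.glue (by linarith) (by linarith) hg (by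
      rw [if_pos (by linarith)]; simp [hl0])
    have e : Set.Icc (-((n + 1 : ℕ) * ε)) ((n + 1 : ℕ) * ε) =
        Set.Icc (-ε + -(n * ε)) (ε + n * ε) := by
      congr 1 <;> push_cast <;> ring
    rw [← e] at hg2
    refine ⟨_, ?_, hg2⟩
    · split_ifs with h1
      · have : n * ε = 0 := by linarith
        rw [this] at hl0 ⊢
        simpa [h0] using hl0
      · exact h0

/-- A globally Lipschitz vector field on a Banach space has a global flow. -/
theorem exists_isFlow {v : X → X} {K : NNReal} (hv : LipschitzWith K v) :
    ∃ φ : ℝ → X → X, IsFlow v φ := by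
  set ε : ℝ := 1 / ((K : ℝ) + 1) with hε
  have hε0 : 0 < ε := by positivity
  choose γ h0 hγ using fun x n => exists_solvesOn hv x n
  have hder : ∀ x (n : ℕ) t, t ∈ Set.Ioo (-(n * ε)) (n * ε) →
      HasDerivAt (γ x n) (v (γ x n t)) t := fun x n t ht =>
    (hγ x n t (Set.Ioo_subset_Icc_self ht)).hasDerivAt (Icc_mem_nhds ht.1 ht.2)
  -- Solutions on intervals of different length agree by uniqueness, so the one used at time `t` may
  -- depend on `t`.
  have huniq : ∀ x (n m : ℕ) t, |t| < n * ε → |t| < m * ε → γ x n t = γ x m t := by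
    intro x n m t hn hm
    wlog hnm : n ≤ m generalizing n m
    · exact (this m n hm hn (not_le.1 hnm).le).symm
    have hle : (n : ℝ) * ε ≤ m * ε := by gcongr
    have hpos : 0 < (n : ℝ) * ε := (abs_nonneg t).trans_lt hn
    exact ODE_solution_unique_of_mem_Ioo (v := fun _ => v) (s := fun _ => Set.univ) (K := K)
      (fun _ _ => hv.lipschitzOnWith) (t₀ := 0) ⟨by linarith, hpos⟩
      (fun s hs => ⟨hder x n s hs, trivial⟩)
      (fun s hs => ⟨hder x m s ⟨by linarith [hs.1], by linarith [hs.2]⟩, trivial⟩)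
      (by rw [h0, h0]) (abs_lt.1 hn)
  have hN : ∀ t : ℝ, ∃ n : ℕ, |t| < n * ε := fun t => by
    obtain ⟨n, hn⟩ := exists_nat_gt (|t| / ε)
    exact ⟨n, (div_lt_iff₀ hε0).1 hn⟩
  choose N hN using hN
  refine ⟨fun t x => γ x (N t) t, fun x => h0 x _, fun x t => ?_⟩
  refine (hder x (N t) t (abs_lt.1 (hN t))).congr_of_eventuallyEq ?_
  filter_upwards [Ioo_mem_nhds (abs_lt.1 (hN t)).1 (abs_lt.1 (hN t)).2] with s hs
  exact huniq x _ _ s (hN s) (abs_lt.2 hs)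

omit [CompleteSpace X]

namespace IsFlow

variable {v : X → X} {φ : ℝ → X → X} {K : NNReal}

lemma continuous (h : IsFlow v φ) (x : X) : Continuous fun t => φ t x :=
  continuous_iff_continuousAt.2 fun t => (h.hasDerivAt x t).continuousAt

lemma eq_of_hasDerivAt (h : IsFlow v φ) (hv : LipschitzWith K v) {γ : ℝ → X}
    (hγ : ∀ t, HasDerivAt γ (v (γ t)) t) (t : ℝ) : γ t = φ t (γ 0) := by
  have := ODE_solution_unique_univ (v := fun _ => v) (s := fun _ => Set.univ) (K := K)
    (fun _ => hv.lipschitzOnWith) (fun t => ⟨hγ t, trivial⟩)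
    (fun t => ⟨h.hasDerivAt (γ 0) t, trivial⟩) (t₀ := 0) (h.zero _).symm
  exact congrFun this t

lemma add (h : IsFlow v φ) (hv : LipschitzWith K v) (s t : ℝ) (x : X) :
    φ (s + t) x = φ s (φ t x) := by
  have := h.eq_of_hasDerivAt hv (γ := fun s => φ (s + t) x)
    (fun s => (h.hasDerivAt x (s + t)).comp_add_const s t) s
  simpa using this

lemma neg_apply (h : IsFlow v φ) (hv : LipschitzWith K v) (t : ℝ) (x : X) :
    φ (-t) (φ t x) = x := by
  rw [← h.add hv, neg_add_cancel, h.zero]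

lemma apply_neg (h : IsFlow v φ) (hv : LipschitzWith K v) (t : ℝ) (x : X) :
    φ t (φ (-t) x) = x := by
  rw [← h.add hv, add_neg_cancel, h.zero]

lemma reverse (h : IsFlow v φ) : IsFlow (fun x => -v x) fun t => φ (-t) where
  zero x := by simpa using h.zero x
  hasDerivAt x t := by
    have := (h.hasDerivAt x (-t)).scomp t (hasDerivAt_neg t)
    simpa [Function.comp_def] using this

lemma dist_le (h : IsFlow v φ) (hv : LipschitzWith K v) {t : ℝ} (ht : 0 ≤ t) (x y : X) :
    dist (φ t x) (φ t y) ≤ dist x y * Real.exp (K * t) := by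
  have := dist_le_of_trajectories_ODE (v := fun _ => v) (a := 0) (b := t) (fun _ => hv)
    (h.continuous x).continuousOn (fun s _ => (h.hasDerivAt x s).hasDerivWithinAt)
    (h.continuous y).continuousOn (fun s _ => (h.hasDerivAt y s).hasDerivWithinAt)
    (δ := dist x y) (by rw [h.zero, h.zero]) t ⟨ht, le_rfl⟩
  simpa using this

lemma continuous_apply (h : IsFlow v φ) (hv : LipschitzWith K v) (t : ℝ) :
    Continuous (φ t) := by
  have key : ∀ {v : X → X} {φ : ℝ → X → X}, IsFlow v φ → LipschitzWith K v → ∀ t, 0 ≤ t →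
      Continuous (φ t) := fun h hv t ht =>
    (LipschitzWith.of_dist_le_mul (K := ⟨Real.exp (K * t), (Real.exp_pos _).le⟩) fun x y => by
      rw [mul_comm]; exact h.dist_le hv ht x y).continuous
  rcases le_total 0 t with ht | ht
  · exact key h hv t ht
  · have := key h.reverse hv.neg (-t) (by linarith)
    simpa using this

/-- Grönwall against the constant curve at `x`, which solves the equation up to an error `‖v x‖`. -/
lemma dist_self_le (h : IsFlow v φ) (hv : LipschitzWith K v) {t : ℝ} (ht : 0 ≤ t) (x : X) :
    dist (φ t x) x ≤ t * Real.exp (K * t) * ‖v x‖ := by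
  have := dist_le_of_approx_trajectories_ODE (v := fun _ => v) (a := 0) (b := t) (fun _ => hv)
    (h.continuous x).continuousOn (fun s _ => (h.hasDerivAt x s).hasDerivWithinAt)
    (εf := 0) (fun s _ => by rw [dist_self]) (g := fun _ => x) (g' := fun _ => 0)
    continuousOn_const (fun s _ => hasDerivWithinAt_const _ _ _) (εg := ‖v x‖)
    (fun s _ => by rw [dist_zero_left]) (δ := 0) (by rw [h.zero, dist_self]) t ⟨ht, le_rfl⟩
  rw [zero_add, sub_zero] at this
  refine this.trans ?_
  have hvx := norm_nonneg (v x)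
  rcases eq_or_ne (K : ℝ) 0 with hK | hK
  · rw [hK, gronwallBound_K0]
    simp [mul_comm]
  · rw [gronwallBound_of_K_ne_0 hK]
    have hKpos : (0 : ℝ) < K := lt_of_le_of_ne K.2 (Ne.symm hK)
    have h1 : Real.exp (K * t) - 1 ≤ K * t * Real.exp (K * t) := by
      have e1 := Real.add_one_le_exp (-(K * t))
      have e2 : Real.exp (-(K * t)) * Real.exp (K * t) = 1 := by rw [← Real.exp_add]; simp
      nlinarith [Real.exp_pos (K * t)]
    simp only [zero_mul, zero_add]
    rw [div_mul_eq_mul_div, div_le_iff₀ hKpos]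
    nlinarith [mul_le_mul_of_nonneg_left h1 hvx]

/-- A consistent one-step method converges to the flow. -/
theorem tendsto_iterate (h : IsFlow v φ) {S : ℝ → X → X} {C : ℝ} (hC : 0 ≤ C)
    (hS : ∀ ε, 0 ≤ ε → ε ≤ 1 → ∀ x y, dist (S ε x) (S ε y) ≤ (1 + C * ε) * dist x y)
    {t : ℝ} (ht : 0 ≤ t) (x : X)
    (hloc : ∃ D, ∀ s ∈ Set.Icc 0 t, ∀ ε, 0 ≤ ε → ε ≤ 1 →
      dist (φ (s + ε) x) (S ε (φ s x)) ≤ D * ε ^ 2) :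
    Filter.Tendsto (fun n : ℕ => (S (t / (n + 1)))^[n + 1] x) Filter.atTop (nhds (φ t x)) := by
  obtain ⟨D, hD⟩ := hloc
  have hD0 : 0 ≤ D := by
    have := hD 0 ⟨le_rfl, ht⟩ 1 zero_le_one le_rfl
    rw [one_pow, mul_one] at this
    exact dist_nonneg.trans this
  have key : ∀ n : ℕ, t / (n + 1) ≤ 1 →
      dist ((S (t / (n + 1)))^[n + 1] x) (φ t x) ≤ (t ^ 2 * D * Real.exp (C * t)) / (n + 1) := by
    intro n hn
    set ε := t / (n + 1) with hε
    have hn1 : (0 : ℝ) < n + 1 := by positivity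
    have hε0 : 0 ≤ ε := by positivity
    have hnε : (n + 1) * ε = t := by rw [hε]; field_simp
    -- Each of the `k` steps adds a local error `D ε²`, and every later step amplifies it by at most
    -- `1 + C ε`.
    have hk : ∀ k : ℕ, k ≤ n + 1 →
        dist (φ (k * ε) x) ((S ε)^[k] x) ≤ k * (D * ε ^ 2) * (1 + C * ε) ^ k := by
      intro k
      induction k with
      | zero => intro _; simp [h.zero]
      | succ k ih =>
        intro hkn
        have hkle : (k : ℝ) ≤ n + 1 := by exact_mod_cast (Nat.le_succ k).trans hkn
        have i1 := hD (k * ε) ⟨by positivity, by rw [← hnε]; gcongr⟩ ε hε0 hn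
        have i2 := hS ε hε0 hn (φ (k * ε) x) ((S ε)^[k] x)
        have i3 := ih ((Nat.le_succ k).trans hkn)
        have hge : 1 ≤ (1 + C * ε) ^ (k + 1) := one_le_pow₀ (by nlinarith [mul_nonneg hC hε0])
        rw [Function.iterate_succ_apply']
        calc dist (φ ((k + 1 : ℕ) * ε) x) (S ε ((S ε)^[k] x))
            ≤ dist (φ ((k + 1 : ℕ) * ε) x) (S ε (φ (k * ε) x)) +
              dist (S ε (φ (k * ε) x)) (S ε ((S ε)^[k] x)) := dist_triangle _ _ _
          _ ≤ D * ε ^ 2 + (1 + C * ε) * (k * (D * ε ^ 2) * (1 + C * ε) ^ k) := by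
              gcongr
              · have e : ((k + 1 : ℕ) : ℝ) * ε = k * ε + ε := by push_cast; ring
                rwa [e]
              · exact i2.trans (by gcongr)
          _ ≤ D * ε ^ 2 * (1 + C * ε) ^ (k + 1) +
              (1 + C * ε) * (k * (D * ε ^ 2) * (1 + C * ε) ^ k) := by
              refine add_le_add_left (le_mul_of_one_le_right (by positivity) hge) _
          _ = _ := by push_cast; ring
    have h1 := hk (n + 1) le_rfl
    rw [dist_comm]
    have e1 : ((n + 1 : ℕ) : ℝ) * ε = t := by push_cast; exact hnε
    rw [e1] at h1
    refine h1.trans ?_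
    have e2 : (1 + C * ε) ^ (n + 1) ≤ Real.exp (C * t) := by
      calc (1 + C * ε) ^ (n + 1) ≤ (Real.exp (C * ε)) ^ (n + 1) := by
            gcongr; linarith [Real.add_one_le_exp (C * ε)]
        _ = Real.exp (C * t) := by
            rw [← Real.exp_nat_mul]; push_cast; rw [← hnε]; ring_nf
    calc ((n + 1 : ℕ) : ℝ) * (D * ε ^ 2) * (1 + C * ε) ^ (n + 1)
        ≤ ((n + 1 : ℕ) : ℝ) * (D * ε ^ 2) * Real.exp (C * t) := by gcongr
      _ = (t ^ 2 * D * Real.exp (C * t)) / (n + 1) := by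
          push_cast; rw [hε]; field_simp
  rw [tendsto_iff_dist_tendsto_zero]
  have hlim : Filter.Tendsto (fun n : ℕ => (t ^ 2 * D * Real.exp (C * t)) / ((n : ℝ) + 1))
      Filter.atTop (nhds 0) :=
    (tendsto_const_nhds).div_atTop
      (Filter.tendsto_atTop_add_const_right _ _ tendsto_natCast_atTop_atTop)
  refine squeeze_zero' (Filter.Eventually.of_forall fun n => dist_nonneg) ?_ hlim
  obtain ⟨N, hN⟩ := exists_nat_ge t
  filter_upwards [Filter.eventually_ge_atTop N] with n hn
  refine key n ?_
  rw [div_le_one (by positivity)]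
  have : (N : ℝ) ≤ n := by exact_mod_cast hn
  linarith

end IsFlow

end Flow
end HMC

namespace HMC

/-! ### Hamiltonian flows preserve volume -/

section Liouville

/-- A pointwise limit of measure preserving maps does not increase the measure of preimages. -/
lemma measure_preimage_le_of_tendsto {X : Type*} [TopologicalSpace X] [MeasurableSpace X]
    [BorelSpace X] {μ : Measure X} [μ.OuterRegular] {T : ℕ → X → X} {T' : X → X}
    (hT : ∀ n, MeasurePreserving (T n) μ μ) (hT' : Measurable T')
    (hlim : ∀ x, Filter.Tendsto (fun n => T n x) Filter.atTop (nhds (T' x)))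
    (A : Set X) : μ (T' ⁻¹' A) ≤ μ A := by
  have hopen : ∀ U : Set X, IsOpen U → μ (T' ⁻¹' U) ≤ μ U := by
    intro U hU
    -- For open `U`, a limit point inside `U` forces `T n x ∈ U` eventually; Fatou's lemma then
    -- gives the inequality, and outer regularity passes to arbitrary sets.
    have h1 : ∀ x, (T' ⁻¹' U).indicator (fun _ => (1 : ENNReal)) x ≤
        Filter.liminf (fun n => (T n ⁻¹' U).indicator (fun _ => (1 : ENNReal)) x)
          Filter.atTop := by
      intro x
      by_cases hx : x ∈ T' ⁻¹' U
      · have hev : ∀ᶠ n in Filter.atTop, T n x ∈ U := hlim x (hU.mem_nhds hx)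
        rw [Set.indicator_of_mem hx]
        refine Filter.le_liminf_of_le (by isBoundedDefault) ?_
        filter_upwards [hev] with n hn
        rw [Set.indicator_of_mem (by exact hn)]
      · rw [Set.indicator_of_notMem hx]
        exact zero_le
    calc μ (T' ⁻¹' U) = ∫⁻ x, (T' ⁻¹' U).indicator (fun _ => (1 : ENNReal)) x ∂μ := by
          rw [lintegral_indicator (hT' hU.measurableSet), lintegral_one,
            Measure.restrict_apply_univ]
      _ ≤ ∫⁻ x, Filter.liminf (fun n => (T n ⁻¹' U).indicator (fun _ => (1 : ENNReal)) x)
          Filter.atTop ∂μ := lintegral_mono h1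
      _ ≤ Filter.liminf (fun n => ∫⁻ x, (T n ⁻¹' U).indicator (fun _ => (1 : ENNReal)) x ∂μ)
          Filter.atTop := lintegral_liminf_le fun n =>
            measurable_const.indicator ((hT n).measurable hU.measurableSet)
      _ = μ U := by
          have : ∀ n, ∫⁻ x, (T n ⁻¹' U).indicator (fun _ => (1 : ENNReal)) x ∂μ = μ U := by
            intro n
            rw [lintegral_indicator ((hT n).measurable hU.measurableSet), lintegral_one,
              Measure.restrict_apply_univ, (hT n).measure_preimage hU.measurableSet.nullMeasurableSet]
          simp [this]
  refine ENNReal.le_of_forall_pos_le_add fun ε hε hfin => ?_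
  obtain ⟨U, hAU, hU, hUε⟩ := A.exists_isOpen_lt_add hfin.ne (by simpa using hε.ne' : (ε : ENNReal) ≠ 0)
  exact (measure_mono (Set.preimage_mono hAU)).trans ((hopen U hU).trans hUε.le)

variable {E : Type*} [NormedAddCommGroup E] [InnerProductSpace ℝ E]

/-- The vector field `(q, p) ↦ (b p, -a q)`. -/
def hamiltonianField (a b : E → E) (z : E × E) : E × E := (b z.2, -a z.1)

/-- One step of the symplectic Euler method for `hamiltonianField a b`. -/
def eulerStep (a b : E → E) (ε : ℝ) (z : E × E) : E × E :=
  (z.1 + ε • b z.2, z.2 - ε • a (z.1 + ε • b z.2))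

lemma lipschitzWith_hamiltonianField {E : Type*} [NormedAddCommGroup E] {a b : E → E} {K : NNReal} (ha : LipschitzWith K a)
    (hb : LipschitzWith K b) : LipschitzWith K (hamiltonianField a b) :=
  LipschitzWith.of_dist_le_mul fun z w => by
    rw [Prod.dist_eq (x := hamiltonianField a b z)]
    refine max_le ?_ ?_
    · exact (hb.dist_le_mul _ _).trans (by gcongr; exact le_max_right _ _)
    · simp only [hamiltonianField, dist_neg_neg]
      exact (ha.dist_le_mul _ _).trans (by gcongr; exact le_max_left _ _)

lemma dist_eulerStep_le {a b : E → E} {K : NNReal} (ha : LipschitzWith K a)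
    (hb : LipschitzWith K b) {ε : ℝ} (hε : 0 ≤ ε) (hε1 : ε ≤ 1) (z w : E × E) :
    dist (eulerStep a b ε z) (eulerStep a b ε w) ≤ (1 + (K + K * K) * ε) * dist z w := by
  have hK : (0 : ℝ) ≤ K := K.2
  have h1 : dist z.1 w.1 ≤ dist z w := le_max_left _ _
  have h2 : dist z.2 w.2 ≤ dist z w := le_max_right _ _
  have hd : 0 ≤ dist z w := dist_nonneg
  have hq : dist (z.1 + ε • b z.2) (w.1 + ε • b w.2) ≤ (1 + K * ε) * dist z w := by
    refine (dist_add_add_le _ _ _ _).trans ?_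
    rw [dist_smul₀, Real.norm_of_nonneg hε]
    have := hb.dist_le_mul z.2 w.2
    have h3 : ε * dist (b z.2) (b w.2) ≤ ε * (K * dist z w) := by
      gcongr; exact this.trans (by gcongr)
    linarith
  rw [Prod.dist_eq]
  refine max_le (hq.trans ?_) ?_
  · gcongr; nlinarith [mul_nonneg hK hK]
  · simp only [eulerStep]
    refine (dist_sub_sub_le _ _ _ _).trans ?_
    rw [dist_smul₀, Real.norm_of_nonneg hε]
    have := ha.dist_le_mul (z.1 + ε • b z.2) (w.1 + ε • b w.2)
    have h3 : ε * dist (a (z.1 + ε • b z.2)) (a (w.1 + ε • b w.2)) ≤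
        ε * (K * ((1 + K * ε) * dist z w)) := by
      gcongr; exact this.trans (by gcongr)
    have h4 : ε * (K * ((1 + K * ε) * dist z w)) ≤ ε * (K * ((1 + K * 1) * dist z w)) := by
      gcongr
    linarith

/-- During a step of length `ε` the trajectory moves by `O(ε)`, so the Lipschitz field varies by
`O(ε)` and the positions differ by `O(ε²)`; no second derivative is needed. The constant is uniform
because the trajectory over `[0, t]` is compact. -/
lemma exists_eulerStep_local_error {a b : E → E} {K : NNReal} (ha : LipschitzWith K a)
    (hb : LipschitzWith K b) {φ : ℝ → E × E → E × E} (hφ : IsFlow (hamiltonianField a b) φ)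
    (t : ℝ) (z : E × E) :
    ∃ D, ∀ s ∈ Set.Icc 0 t, ∀ ε, 0 ≤ ε → ε ≤ 1 →
      dist (φ (s + ε) z) (eulerStep a b ε (φ s z)) ≤ D * ε ^ 2 := by
  have hv := lipschitzWith_hamiltonianField ha hb
  obtain ⟨M₀, hM₀⟩ := (isCompact_Icc (a := (0 : ℝ)) (b := t)).exists_bound_of_continuousOn
    (f := fun s => hamiltonianField a b (φ s z)) (hv.continuous.comp (hφ.continuous z)).continuousOn
  set M := Real.exp K * max M₀ 0 with hM
  have hM0 : 0 ≤ M := by positivity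
  have hexp : (1 : ℝ) ≤ Real.exp K := Real.one_le_exp K.2
  refine ⟨2 * (K * M), fun s hs ε hε hε1 => ?_⟩
  have hspeed : ‖hamiltonianField a b (φ s z)‖ ≤ M :=
    (hM₀ s hs).trans ((le_max_left _ _).trans (le_mul_of_one_le_left (le_max_right _ _) hexp))
  have hmove : ∀ r ∈ Set.Icc 0 ε, dist (φ (s + r) z) (φ s z) ≤ M * ε := by
    intro r hr
    rw [add_comm, hφ.add hv]
    refine (hφ.dist_self_le hv hr.1 _).trans ?_
    have e1 : Real.exp (K * r) ≤ Real.exp K :=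
      Real.exp_le_exp.2 (by nlinarith [K.2, hr.2, hr.1])
    calc r * Real.exp (K * r) * ‖hamiltonianField a b (φ s z)‖
        ≤ ε * Real.exp K * max M₀ 0 := by
          gcongr
          · exact hr.2
          · exact (hM₀ s hs).trans (le_max_left _ _)
      _ = M * ε := by rw [hM]; ring
  have hder : ∀ r, HasDerivAt (fun r => φ (s + r) z) (hamiltonianField a b (φ (s + r) z)) r :=
    fun r => (hφ.hasDerivAt z (s + r)).comp_const_add s r
  have hq : dist (φ (s + ε) z).1 ((φ s z).1 + ε • b (φ s z).2) ≤ K * M * ε ^ 2 := by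
    have := norm_image_sub_le_of_norm_deriv_le_segment' (a := 0) (b := ε)
      (f := fun r => (φ (s + r) z).1 - r • b (φ s z).2)
      (f' := fun r => b (φ (s + r) z).2 - b (φ s z).2) (C := K * (M * ε))
      (fun r _ => by
        have h1 := (hasFDerivAt_fst.comp_hasDerivAt r (hder r)).sub
          ((hasDerivAt_id r).smul_const (b (φ s z).2))
        have h2 := h1.hasDerivWithinAt (s := Set.Icc 0 ε)
        refine h2.congr_deriv ?_
        simp [hamiltonianField])
      (fun r hr => by
        rw [← dist_eq_norm]
        refine (hb.dist_le_mul _ _).trans ?_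
        gcongr
        exact (le_max_right _ _).trans (hmove r (Set.Ico_subset_Icc_self hr)))
      ε ⟨hε, le_rfl⟩
    rw [dist_eq_norm]
    simp only [add_zero, zero_smul, sub_zero] at this
    refine (le_of_eq ?_).trans (this.trans (le_of_eq (by ring)))
    congr 1; abel
  have hstep : dist (φ s z).1 ((φ s z).1 + ε • b (φ s z).2) ≤ M * ε := by
    rw [dist_self_add_right, norm_smul, Real.norm_of_nonneg hε, mul_comm]
    gcongr
    exact (le_max_left _ _).trans hspeed
  have hp : dist (φ (s + ε) z).2
      ((φ s z).2 - ε • a ((φ s z).1 + ε • b (φ s z).2)) ≤ 2 * (K * M) * ε ^ 2 := by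
    set q' := (φ s z).1 + ε • b (φ s z).2 with hq'
    have := norm_image_sub_le_of_norm_deriv_le_segment' (a := 0) (b := ε)
      (f := fun r => (φ (s + r) z).2 + r • a q')
      (f' := fun r => a q' - a (φ (s + r) z).1) (C := K * (2 * (M * ε)))
      (fun r _ => by
        have h1 := (hasFDerivAt_snd.comp_hasDerivAt r (hder r)).add
          ((hasDerivAt_id r).smul_const (a q'))
        have h2 := h1.hasDerivWithinAt (s := Set.Icc 0 ε)
        refine h2.congr_deriv ?_
        simp [hamiltonianField]; abel)
      (fun r hr => by
        rw [← dist_eq_norm]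
        refine (ha.dist_le_mul _ _).trans ?_
        gcongr
        have e1 : dist (φ (s + r) z).1 (φ s z).1 ≤ M * ε :=
          (le_max_left _ _).trans (hmove r (Set.Ico_subset_Icc_self hr))
        have e2 := dist_triangle_left q' (φ (s + r) z).1 (φ s z).1
        rw [dist_comm] at e1
        linarith)
      ε ⟨hε, le_rfl⟩
    rw [dist_eq_norm]
    simp only [add_zero, zero_smul, sub_zero] at this
    refine (le_of_eq ?_).trans (this.trans (le_of_eq (by ring)))
    congr 1; abel
  rw [Prod.dist_eq]
  refine max_le (hq.trans ?_) hp
  have : 0 ≤ (K : ℝ) * M * ε ^ 2 := by positivity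
  linarith

variable [FiniteDimensional ℝ E] [MeasurableSpace E] [BorelSpace E]

lemma measurePreserving_shear {c : E → E} (hc : Measurable c) :
    MeasurePreserving (fun z : E × E => (z.1, z.2 + c z.1)) volume volume :=
  (MeasurePreserving.id (volume : Measure E)).skew_product (g := fun q p => p + c q)
    (by fun_prop) (Filter.Eventually.of_forall fun q =>
      (measurePreserving_add_right volume (c q)).map_eq)

/-- The step is a shear in the position followed by a shear in the momentum; the first is conjugated
by the swap. -/
lemma measurePreserving_eulerStep {a b : E → E} (ha : Measurable a) (hb : Measurable b) (ε : ℝ) :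
    MeasurePreserving (eulerStep a b ε) volume volume := by
  have hs : MeasurePreserving (Prod.swap : E × E → E × E) volume volume :=
    Measure.measurePreserving_swap
  have h1 := hs.comp ((measurePreserving_shear (hb.const_smul ε)).comp hs)
  have h2 := (measurePreserving_shear (ha.const_smul (-ε))).comp h1
  convert h2 using 1
  ext z <;> simp [eulerStep, sub_eq_add_neg]

/-- **Liouville's theorem** for separable Hamiltonians with Lipschitz gradients. -/
theorem IsFlow.measurePreserving {a b : E → E} {K : NNReal} (ha : LipschitzWith K a)
    (hb : LipschitzWith K b) {φ : ℝ → E × E → E × E} (hφ : IsFlow (hamiltonianField a b) φ)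
    {t : ℝ} (ht : 0 ≤ t) : MeasurePreserving (φ t) volume volume := by
  have key : ∀ {a b : E → E} {φ : ℝ → E × E → E × E}, LipschitzWith K a → LipschitzWith K b →
      IsFlow (hamiltonianField a b) φ → ∀ A, volume (φ t ⁻¹' A) ≤ volume A := by
    intro a b φ ha hb hφ A
    refine measure_preimage_le_of_tendsto
      (T := fun n => (eulerStep a b (t / (n + 1)))^[n + 1])
      (fun n => (measurePreserving_eulerStep ha.continuous.measurable hb.continuous.measurable
        _).iterate _)
      (hφ.continuous_apply (lipschitzWith_hamiltonianField ha hb) t).measurable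
      (fun z => hφ.tendsto_iterate (C := K + K * K) (by positivity)
        (fun ε h0 h1 => dist_eulerStep_le ha hb h0 h1) ht z
        (exists_eulerStep_local_error ha hb hφ t z)) A
  have hv := lipschitzWith_hamiltonianField ha hb
  -- The reversed flow is again of this form, and its inequality, applied to the preimage of `A`, is
  -- the opposite one.
  have hrev : IsFlow (hamiltonianField (fun x => -a x) fun x => -b x) fun t => φ (-t) :=
    hφ.reverse
  refine ⟨(hφ.continuous_apply hv t).measurable, ?_⟩
  ext A hA
  rw [Measure.map_apply (hφ.continuous_apply hv t).measurable hA]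
  refine le_antisymm (key ha hb hφ A) ?_
  have h1 := key ha.neg hb.neg hrev (φ t ⁻¹' A)
  have h2 : (φ (-t)) ⁻¹' (φ t ⁻¹' A) = A := by
    ext z
    simp [hφ.apply_neg hv]
  rwa [h2] at h1

end Liouville
end HMC

namespace HMC

/-! ### Short time estimates for Hamiltonian flows -/

section Estimates

variable {E : Type*} [NormedAddCommGroup E] [InnerProductSpace ℝ E]

/-- To solve `Ψ p = y`, iterate `p ↦ p - τ (Ψ p - y)`. With `τ = c / l²` squared distances shrink by
the factor `1 - c² / l²`. -/
lemma surjective_of_strongly_monotone [CompleteSpace E] {Ψ : E → E} {c l : ℝ} (hc : 0 < c)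
    (hl : 0 < l) (hmono : ∀ x y, c * ‖x - y‖ ^ 2 ≤ inner ℝ (x - y) (Ψ x - Ψ y))
    (hlip : ∀ x y, ‖Ψ x - Ψ y‖ ≤ l * ‖x - y‖) : Function.Surjective Ψ := by
  intro y
  set τ := c / l ^ 2 with hτ
  have hτ0 : 0 < τ := by positivity
  set k := 1 - c ^ 2 / l ^ 2 with hk
  have hk1 : √k < 1 := by
    rw [Real.sqrt_lt' one_pos]
    have : 0 < c ^ 2 / l ^ 2 := by positivity
    linarith
  have hcon : ContractingWith ⟨√k, Real.sqrt_nonneg _⟩ fun p => p - τ • (Ψ p - y) := by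
    refine ⟨by exact_mod_cast hk1, LipschitzWith.of_dist_le_mul fun p r => ?_⟩
    rw [dist_eq_norm, dist_eq_norm]
    have e : p - τ • (Ψ p - y) - (r - τ • (Ψ r - y)) = (p - r) - τ • (Ψ p - Ψ r) := by
      module
    rw [e]
    have h1 : ‖(p - r) - τ • (Ψ p - Ψ r)‖ ^ 2 ≤ k * ‖p - r‖ ^ 2 := by
      rw [norm_sub_sq_real, inner_smul_right, norm_smul, Real.norm_of_nonneg hτ0.le, mul_pow]
      have h2 := mul_le_mul_of_nonneg_left (hmono p r) hτ0.le
      have h3 : τ ^ 2 * ‖Ψ p - Ψ r‖ ^ 2 ≤ τ ^ 2 * (l * ‖p - r‖) ^ 2 := by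
        gcongr; exact hlip p r
      have h4 : τ ^ 2 * (l * ‖p - r‖) ^ 2 = c ^ 2 / l ^ 2 * ‖p - r‖ ^ 2 := by
        rw [hτ]; field_simp
      have h5 : τ * (c * ‖p - r‖ ^ 2) = c ^ 2 / l ^ 2 * ‖p - r‖ ^ 2 := by
        rw [hτ]; field_simp
      rw [hk]
      linarith
    have h2 := Real.le_sqrt_of_sq_le h1
    rwa [Real.sqrt_mul' _ (sq_nonneg _), Real.sqrt_sq (norm_nonneg _)] at h2
  have hfix := hcon.fixedPoint_isFixedPt
  set p := ContractingWith.fixedPoint _ hcon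
  refine ⟨p, ?_⟩
  have h1 : p - τ • (Ψ p - y) = p := hfix
  have h2 : τ • (Ψ p - y) = 0 := by
    have := congrArg (fun u => p - u) h1
    simpa using this
  rcases smul_eq_zero.1 h2 with h | h
  · exact absurd h hτ0.ne'
  · exact sub_eq_zero.1 h

variable [FiniteDimensional ℝ E] {F G : E → ℝ} {m L : ℝ} {φ : ℝ → E × E → E × E}

namespace IsFlow

variable (hF : IsRegularPotential F m L) (hG : IsRegularPotential G m L)
  (hφ : IsFlow (hamiltonianField (gradient F) (gradient G)) φ)

include hF hG hφ

/-- Conservation of energy. -/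
lemma energy_eq (t : ℝ) (z : E × E) : F (φ t z).1 + G (φ t z).2 = F z.1 + G z.2 := by
  have hder : ∀ s, HasDerivAt (fun s => F (φ s z).1 + G (φ s z).2) 0 s := by
    intro s
    have h1 := hasFDerivAt_fst.comp_hasDerivAt s (hφ.hasDerivAt z s)
    have h2 := hasFDerivAt_snd.comp_hasDerivAt s (hφ.hasDerivAt z s)
    have h3 := (hF.hasGradientAt (φ s z).1).hasFDerivAt.comp_hasDerivAt s h1
    have h4 := (hG.hasGradientAt (φ s z).2).hasFDerivAt.comp_hasDerivAt s h2
    refine (h3.add h4).congr_deriv ?_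
    simp only [hamiltonianField, InnerProductSpace.toDual_apply_apply, ContinuousLinearMap.coe_fst',
      ContinuousLinearMap.coe_snd', inner_neg_right]
    rw [real_inner_comm]; ring
  have := is_const_of_deriv_eq_zero (fun s => (hder s).differentiableAt) (fun s => (hder s).deriv)
    t 0
  simpa [hφ.zero] using this

omit hφ in
lemma lipschitz_field :
    LipschitzWith L.toNNReal (hamiltonianField (gradient F) (gradient G)) :=
  lipschitzWith_hamiltonianField hF.lipschitzWith hG.lipschitzWith

lemma dist_le_exp {t : ℝ} (ht : 0 ≤ t) (ht1 : t ≤ 1) (z w : E × E) :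
    dist (φ t z) (φ t w) ≤ Real.exp L * dist z w := by
  have := hφ.dist_le (lipschitz_field hF hG) ht z w
  rw [Real.coe_toNNReal _ hF.nonneg] at this
  rw [mul_comm]
  refine this.trans ?_
  gcongr
  nlinarith [hF.nonneg]

/-- For short times the position depends strongly monotonically on the initial momentum. -/
lemma inner_position_sub_ge {t : ℝ} (ht : 0 ≤ t) (ht1 : t ≤ 1) (h₁ : L * Real.exp L * t ≤ 1 / 8)
    (h₂ : (L * Real.exp L) ^ 2 * t ≤ m / 8) (q p₁ p₂ : E) :
    m / 2 * t * ‖p₁ - p₂‖ ^ 2 ≤ inner ℝ (p₁ - p₂) ((φ t (q, p₁)).1 - (φ t (q, p₂)).1) := by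
  have hL := hF.nonneg
  have hm := hF.pos
  set D := ‖p₁ - p₂‖ with hD
  have hD0 : 0 ≤ D := norm_nonneg _
  set Λ := L * Real.exp L with hΛ
  have hΛ0 : 0 ≤ Λ := by positivity
  have hdist : ∀ s ∈ Set.Icc 0 t, dist (φ s (q, p₁)) (φ s (q, p₂)) ≤ Real.exp L * D := by
    intro s hs
    refine (dist_le_exp hF hG hφ hs.1 (hs.2.trans ht1) _ _).trans (le_of_eq ?_)
    rw [Prod.dist_eq, dist_self, dist_eq_norm, max_eq_right (norm_nonneg _)]
  have hderp : ∀ p s, HasDerivAt (fun s => (φ s (q, p)).2) (-gradient F (φ s (q, p)).1) s :=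
    fun p s => by
      have := hasFDerivAt_snd.comp_hasDerivAt s (hφ.hasDerivAt (q, p) s)
      exact this
  have hderq : ∀ p s, HasDerivAt (fun s => (φ s (q, p)).1) (gradient G (φ s (q, p)).2) s :=
    fun p s => by
      have := hasFDerivAt_fst.comp_hasDerivAt s (hφ.hasDerivAt (q, p) s)
      exact this
  have hP : ∀ s ∈ Set.Icc 0 t,
      ‖((φ s (q, p₁)).2 - (φ s (q, p₂)).2) - (p₁ - p₂)‖ ≤ Λ * D * s := by
    intro s hs
    have := norm_image_sub_le_of_norm_deriv_le_segment' (a := 0) (b := t)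
      (f := fun s => (φ s (q, p₁)).2 - (φ s (q, p₂)).2)
      (f' := fun s => -gradient F (φ s (q, p₁)).1 - -gradient F (φ s (q, p₂)).1) (C := Λ * D)
      (fun s _ => ((hderp p₁ s).sub (hderp p₂ s)).hasDerivWithinAt)
      (fun s hs => by
        rw [neg_sub_neg, norm_sub_rev]
        refine (hF.lip _ _).trans ?_
        rw [hΛ, mul_assoc, ← dist_eq_norm]
        gcongr
        exact (le_max_left _ _).trans (hdist s (Set.Ico_subset_Icc_self hs)))
      s hs
    simpa [hφ.zero] using this
  let u : ℝ → ℝ := fun s => inner ℝ (p₁ - p₂) ((φ s (q, p₁)).1 - (φ s (q, p₂)).1) -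
    m / 2 * s * D ^ 2
  have hu : ∀ s, HasDerivAt u (inner ℝ (p₁ - p₂)
      (gradient G (φ s (q, p₁)).2 - gradient G (φ s (q, p₂)).2) - m / 2 * D ^ 2) s := by
    intro s
    have h1 := (innerSL ℝ (p₁ - p₂)).hasFDerivAt.comp_hasDerivAt s
      ((hderq p₁ s).sub (hderq p₂ s))
    have h2 := ((hasDerivAt_id s).const_mul (m / 2)).mul_const (D ^ 2)
    refine (h1.sub h2).congr_deriv ?_
    rw [innerSL_apply_apply, mul_one]
  have hmono : MonotoneOn u (Set.Icc 0 t) := by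
    refine monotoneOn_of_deriv_nonneg (convex_Icc _ _)
      (fun s _ => (hu s).continuousAt.continuousWithinAt)
      (fun s _ => (hu s).differentiableAt.differentiableWithinAt) fun s hs => ?_
    rw [interior_Icc] at hs
    have hs' := Set.Ioo_subset_Icc_self hs
    rw [(hu s).deriv]
    -- The momentum difference `A` stays within `D / 8` of `p₁ - p₂`, so `⟪A, B⟫ ≥ m (7/8)² D²`.
    -- Replacing `A` by `p₁ - p₂` costs at most `m / 8 * D²`, which leaves `41/64 m D²`, more than
    -- `m / 2 * D²`.
    set A := (φ s (q, p₁)).2 - (φ s (q, p₂)).2 with hA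
    set B := gradient G (φ s (q, p₁)).2 - gradient G (φ s (q, p₂)).2 with hB
    have e1 : m * ‖A‖ ^ 2 ≤ inner ℝ B A := hG.mono _ _
    have e2 : ‖B‖ ≤ Λ * D := by
      refine (hG.lip _ _).trans ?_
      rw [hΛ, mul_assoc, ← dist_eq_norm]
      gcongr
      exact (le_max_right _ _).trans (hdist s hs')
    have e3 := hP s hs'
    have hΛs : Λ * s ≤ 1 / 8 := (mul_le_mul_of_nonneg_left hs'.2 hΛ0).trans h₁
    have hΛs2 : Λ ^ 2 * s ≤ m / 8 :=
      (mul_le_mul_of_nonneg_left hs'.2 (sq_nonneg _)).trans h₂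
    have e4 : ‖A - (p₁ - p₂)‖ ≤ 1 / 8 * D := e3.trans (by nlinarith)
    have e5 : 7 / 8 * D ≤ ‖A‖ := by
      have := norm_sub_norm_le (p₁ - p₂) A
      rw [norm_sub_rev (p₁ - p₂) A] at this
      linarith
    have hs0 : 0 ≤ s := hs'.1
    have e6 : m * (7 / 8 * D) ^ 2 ≤ m * ‖A‖ ^ 2 := by gcongr
    have e7 : inner ℝ (A - (p₁ - p₂)) B ≤ m / 8 * D ^ 2 := by
      refine (real_inner_le_norm _ _).trans ?_
      calc ‖A - (p₁ - p₂)‖ * ‖B‖ ≤ (Λ * D * s) * (Λ * D) := by gcongr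
        _ = (Λ ^ 2 * s) * D ^ 2 := by ring
        _ ≤ _ := by gcongr
    rw [inner_sub_left, real_inner_comm] at e7
    nlinarith [mul_nonneg hm.le (sq_nonneg D)]
  have := hmono (Set.left_mem_Icc.2 ht) (Set.right_mem_Icc.2 ht) ht
  simp only [u, hφ.zero, sub_self, inner_zero_right, mul_zero, zero_mul] at this
  linarith

/-- The momentum at a short positive time grows linearly in the initial position. -/
lemma exists_norm_momentum_ge {t : ℝ} (ht : 0 ≤ t) (ht1 : t ≤ 1)
    (h₂ : (L * Real.exp L) ^ 2 * t ≤ m / 8) :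
    ∃ B, 0 ≤ B ∧ ∀ q p, m / 2 * t * ‖q‖ ≤ ‖(φ t (q, p)).2‖ + B * (1 + ‖p‖) := by
  have hL := hF.nonneg
  have hm := hF.pos
  set A₀ := ‖gradient F 0‖ + ‖gradient G 0‖ with hA₀
  have hA₀0 : 0 ≤ A₀ := by positivity
  have he : 1 ≤ Real.exp L := Real.one_le_exp hL
  refine ⟨1 + A₀ + L * Real.exp L * (A₀ + L), by positivity, fun q p => ?_⟩
  set M := A₀ + L * ‖q‖ + L * ‖p‖ with hM
  have hM0 : 0 ≤ M := by positivity
  have hv : ‖hamiltonianField (gradient F) (gradient G) (q, p)‖ ≤ M := by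
    refine max_le ?_ ?_
    · refine (hG.norm_gradient_le p).trans ?_
      have : 0 ≤ L * ‖q‖ := by positivity
      simp only [hM, hA₀]
      linarith [norm_nonneg (gradient F 0)]
    · simp only [hamiltonianField, norm_neg]
      refine (hF.norm_gradient_le q).trans ?_
      have : 0 ≤ L * ‖p‖ := by positivity
      simp only [hM, hA₀]
      linarith [norm_nonneg (gradient G 0)]
  have hmove : ∀ s ∈ Set.Icc 0 t, dist (φ s (q, p)) (q, p) ≤ t * Real.exp L * M := by
    intro s hs
    have := hφ.dist_self_le (lipschitz_field hF hG) hs.1 (q, p)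
    rw [Real.coe_toNNReal _ hL] at this
    refine this.trans ?_
    have : L * s ≤ L := mul_le_of_le_one_right hL (hs.2.trans ht1)
    gcongr
    exact hs.2
  -- To first order the momentum is `p - t ∇F(q)`, and `‖∇F(q)‖` is at least `m ‖q‖` minus a
  -- constant. The second order error in `q` is at most `m / 8 * t * ‖q‖` by `h₂`.
  have hP : ‖(φ t (q, p)).2 + t • gradient F q - p‖ ≤ L * (t * Real.exp L * M) * t := by
    have := norm_image_sub_le_of_norm_deriv_le_segment' (a := 0) (b := t)
      (f := fun s => (φ s (q, p)).2 + s • gradient F q)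
      (f' := fun s => gradient F q - gradient F (φ s (q, p)).1)
      (C := L * (t * Real.exp L * M))
      (fun s _ => by
        have h1 := (hasFDerivAt_snd.comp_hasDerivAt s (hφ.hasDerivAt (q, p) s)).add
          ((hasDerivAt_id s).smul_const (gradient F q))
        refine (h1.hasDerivWithinAt (s := Set.Icc 0 t)).congr_deriv ?_
        simp [hamiltonianField]; abel)
      (fun s hs => by
        refine (hF.lip _ _).trans ?_
        gcongr
        rw [← dist_eq_norm, dist_comm]
        exact (le_max_left _ _).trans (hmove s (Set.Ico_subset_Icc_self hs)))
      t ⟨ht, le_rfl⟩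
    simpa [hφ.zero] using this
  have hq := hF.le_norm_gradient q
  have e1 : t * ‖gradient F q‖ ≤ ‖(φ t (q, p)).2‖ + ‖p‖ + L * (t * Real.exp L * M) * t := by
    have e : t • gradient F q = ((φ t (q, p)).2 + t • gradient F q - p) + p - (φ t (q, p)).2 := by
      abel
    have h1 : ‖t • gradient F q‖ = t * ‖gradient F q‖ := by
      rw [norm_smul, Real.norm_of_nonneg ht]
    rw [← h1, e]
    refine (norm_sub_le _ _).trans ?_
    have := norm_add_le ((φ t (q, p)).2 + t • gradient F q - p) p
    linarith
  have e2 : t * (m * ‖q‖ - A₀) ≤ t * ‖gradient F q‖ := by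
    gcongr
    simp only [hA₀]
    linarith [norm_nonneg (gradient G 0)]
  have e3 : L ^ 2 * Real.exp L * t ≤ m / 8 := by
    refine le_trans ?_ h₂
    rw [mul_pow]
    gcongr
    nlinarith
  have e4 : L * (t * Real.exp L * M) * t ≤
      m / 8 * t * ‖q‖ + L * Real.exp L * (A₀ + L * ‖p‖) := by
    have f1 : L * (t * Real.exp L * M) * t =
        (L ^ 2 * Real.exp L * t) * (t * ‖q‖) + (t * t) * (L * Real.exp L * (A₀ + L * ‖p‖)) := by
      rw [hM]; ring
    rw [f1]
    have f2 : (L ^ 2 * Real.exp L * t) * (t * ‖q‖) ≤ m / 8 * (t * ‖q‖) := by gcongr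
    have f3 : (t * t) * (L * Real.exp L * (A₀ + L * ‖p‖)) ≤
        1 * (L * Real.exp L * (A₀ + L * ‖p‖)) := by
      gcongr; nlinarith
    linarith
  have e5 : t * A₀ ≤ A₀ := mul_le_of_le_one_left hA₀0 ht1
  have e6 : 0 ≤ m * t * ‖q‖ := by positivity
  have e7 : 0 ≤ L * Real.exp L * L := by positivity
  have e8 : 0 ≤ L * Real.exp L * A₀ * ‖p‖ := by positivity
  have e9 : 0 ≤ A₀ * ‖p‖ := by positivity
  nlinarith [norm_nonneg p]

/-- A drift inequality for the potential energy at short positive times. -/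
theorem exists_drift {t : ℝ} (ht : 0 < t) (ht1 : t ≤ 1)
    (h₂ : (L * Real.exp L) ^ 2 * t ≤ m / 8) {C : ℝ} (hC : 0 ≤ C)
    (hFC : ∀ x, m / 4 * ‖x‖ ^ 2 - C ≤ F x ∧ F x ≤ C * (1 + ‖x‖ ^ 2))
    (hGC : ∀ x, m / 4 * ‖x‖ ^ 2 - C ≤ G x ∧ G x ≤ C * (1 + ‖x‖ ^ 2)) :
    ∃ γ D : ℝ, 0 ≤ γ ∧ γ < 1 ∧ 0 ≤ D ∧ ∀ q p,
      F (φ t (q, p)).1 + C ≤ γ * (F q + C) + D * (1 + ‖p‖ ^ 2) := by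
  have hm := hF.pos
  obtain ⟨B, hB, hgrow⟩ := exists_norm_momentum_ge hF hG hφ ht.le ht1 h₂
  -- `k ‖q‖²` is the kinetic energy gained, up to terms in `p`. Since `F q + C ≤ (2 C + 1) (‖q‖² +
  -- 1)`, this removes the fraction `δ` of the potential energy.
  set k := m / 4 * ((m * t) ^ 2 / 8) with hk
  have hk0 : 0 < k := by positivity
  set δ := k / (2 * C + 1) with hδ
  have hδ0 : 0 < δ := by positivity
  refine ⟨max 0 (1 - δ), m / 4 * (2 * B ^ 2) + 2 * C + k, le_max_left _ _,
    max_lt one_pos (by linarith), by positivity, fun q p => ?_⟩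
  have hen := energy_eq hF hG hφ t (q, p)
  simp only at hen
  set P := (φ t (q, p)).2
  have h1 := hgrow q p
  have h2 : (m * t) ^ 2 / 8 * ‖q‖ ^ 2 ≤ ‖P‖ ^ 2 + 2 * B ^ 2 * (1 + ‖p‖ ^ 2) := by
    have a1 : (m / 2 * t * ‖q‖) ^ 2 ≤ (‖P‖ + B * (1 + ‖p‖)) ^ 2 := by gcongr
    have a2 : (‖P‖ + B * (1 + ‖p‖)) ^ 2 ≤ 2 * ‖P‖ ^ 2 + 2 * (B * (1 + ‖p‖)) ^ 2 := by
      nlinarith [sq_nonneg (‖P‖ - B * (1 + ‖p‖))]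
    have a3 : (B * (1 + ‖p‖)) ^ 2 ≤ 2 * B ^ 2 * (1 + ‖p‖ ^ 2) := by
      rw [mul_pow]
      nlinarith [mul_nonneg (sq_nonneg B) (sq_nonneg (1 - ‖p‖))]
    have a4 : (m / 2 * t * ‖q‖) ^ 2 = 2 * ((m * t) ^ 2 / 8 * ‖q‖ ^ 2) := by ring
    linarith
  have h3 := (hGC P).1
  have h4 := (hGC p).2
  have h5 : k * ‖q‖ ^ 2 ≤ m / 4 * ‖P‖ ^ 2 + m / 4 * (2 * B ^ 2) * (1 + ‖p‖ ^ 2) := by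
    have := mul_le_mul_of_nonneg_left h2 (by positivity : 0 ≤ m / 4)
    rw [hk]
    linarith
  have h6 : δ * (F q + C) ≤ k * ‖q‖ ^ 2 + k := by
    have b1 : F q + C ≤ (2 * C + 1) * (‖q‖ ^ 2 + 1) := by
      nlinarith [(hFC q).2, mul_nonneg hC (sq_nonneg ‖q‖), sq_nonneg ‖q‖]
    calc δ * (F q + C) ≤ δ * ((2 * C + 1) * (‖q‖ ^ 2 + 1)) := by gcongr
      _ = k * ‖q‖ ^ 2 + k := by rw [hδ]; field_simp
  have hV0 : 0 ≤ F q + C := by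
    have : 0 ≤ m / 4 * ‖q‖ ^ 2 := by positivity
    linarith [(hFC q).1]
  have h7 : (1 - δ) * (F q + C) ≤ max 0 (1 - δ) * (F q + C) := by
    gcongr; exact le_max_right _ _
  have h8 : 0 ≤ (C + k) * ‖p‖ ^ 2 := by positivity
  nlinarith

end IsFlow

end Estimates
end HMC

namespace HMC

/-! ### Gibbs measures and the contraction for Hamiltonian averaging -/

section Gibbs

variable {E : Type*} [NormedAddCommGroup E] [InnerProductSpace ℝ E] [FiniteDimensional ℝ E]
  [MeasurableSpace E] [BorelSpace E]

/-- The measure with density `exp (-F)`. -/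
noncomputable def gibbs (F : E → ℝ) : Measure E :=
  volume.withDensity fun x => ENNReal.ofReal (Real.exp (-F x))

lemma integrable_gibbs_iff {F : E → ℝ} (hF : Measurable F) {u : E → ℝ} :
    Integrable u (gibbs F) ↔ Integrable fun x => u x * Real.exp (-F x) := by
  rw [gibbs, integrable_withDensity_iff (by fun_prop) (by simp)]
  simp only [ENNReal.toReal_ofReal (Real.exp_pos _).le]

lemma integral_gibbs {F : E → ℝ} (hF : Measurable F) (u : E → ℝ) :
    ∫ x, u x ∂gibbs F = ∫ x, u x * Real.exp (-F x) := by
  rw [gibbs, integral_withDensity_eq_integral_toReal_smul (by fun_prop) (by simp)]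
  simp only [ENNReal.toReal_ofReal (Real.exp_pos _).le, smul_eq_mul, mul_comm]

lemma gibbs_absolutelyContinuous (F : E → ℝ) : gibbs F ≪ volume :=
  withDensity_absolutelyContinuous _ _

lemma absolutelyContinuous_gibbs {F : E → ℝ} (hF : Measurable F) : volume ≪ gibbs F :=
  withDensity_absolutelyContinuous' (by fun_prop)
    (Filter.Eventually.of_forall fun x => by simpa using Real.exp_pos (-F x))

lemma IsRegularPotential.integrable_quadratic {F : E → ℝ} {m L : ℝ}
    (h : IsRegularPotential F m L) : Integrable (fun x => 1 + ‖x‖ ^ 2) (gibbs F) :=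
  (integrable_gibbs_iff h.continuous.measurable).2 h.integrable_quadratic_mul_exp_neg

lemma IsRegularPotential.integrable_exp_neg {F : E → ℝ} {m L : ℝ}
    (h : IsRegularPotential F m L) : Integrable fun x => Real.exp (-F x) := by
  have hc := h.continuous
  refine h.integrable_quadratic_mul_exp_neg.mono' (by fun_prop)
    (Filter.Eventually.of_forall fun x => ?_)
  rw [Real.norm_of_nonneg (Real.exp_pos _).le]
  exact le_mul_of_one_le_left (Real.exp_pos _).le (by nlinarith [sq_nonneg ‖x‖])

lemma IsRegularPotential.isFiniteMeasure_gibbs {F : E → ℝ} {m L : ℝ}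
    (h : IsRegularPotential F m L) : IsFiniteMeasure (gibbs F) := by
  refine ⟨?_⟩
  rw [gibbs, withDensity_apply _ MeasurableSet.univ, Measure.restrict_univ]
  have := h.integrable_exp_neg.lintegral_lt_top
  exact this

/-- Lebesgue measure is a multiple of Hausdorff measure, which a `K`-Lipschitz map expands by at
most `K ^ n`. This does the work of a change of variables. -/
lemma volume_le_of_subset_image {Ψ : E → E} {K : NNReal} (hΨ : LipschitzWith K Ψ) {A S : Set E}
    (hAS : A ⊆ Ψ '' S) :
    volume A ≤ (K : ENNReal) ^ (Module.finrank ℝ E) * volume S := by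
  have h1 : ∀ B : Set E, volume B = Measure.addHaarScalarFactor (volume : Measure E)
      (Measure.hausdorffMeasure (Module.finrank ℝ E : ℝ)) •
      (Measure.hausdorffMeasure (Module.finrank ℝ E : ℝ) : Measure E) B := by
    intro B
    conv_lhs => rw [Measure.isAddLeftInvariant_eq_smul (volume : Measure E)
      (Measure.hausdorffMeasure (Module.finrank ℝ E : ℝ))]
    rfl
  have h2 := hΨ.hausdorffMeasure_image_le (d := (Module.finrank ℝ E : ℝ)) (by positivity) S
  rw [ENNReal.rpow_natCast] at h2
  rw [h1 A, h1 S, ENNReal.smul_def, ENNReal.smul_def, smul_eq_mul, smul_eq_mul, mul_left_comm]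
  gcongr
  exact (measure_mono hAS).trans h2

variable {F G : E → ℝ} {m L : ℝ} {φ : ℝ → E × E → E × E}

/-- A minorization condition for the position after a short time, uniform over bounded sets of
initial positions. -/
theorem IsFlow.exists_minorization (hF : IsRegularPotential F m L) (hG : IsRegularPotential G m L)
    (hφ : IsFlow (hamiltonianField (gradient F) (gradient G)) φ) {t : ℝ} (ht : 0 < t) (ht1 : t ≤ 1)
    (h₁ : L * Real.exp L * t ≤ 1 / 8) (h₂ : (L * Real.exp L) ^ 2 * t ≤ m / 8) (r : ℝ) :
    ∃ α : ℝ, 0 < α ∧ ∃ ν : Measure E, IsProbabilityMeasure ν ∧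
      ∀ q, ‖q‖ ≤ r → ENNReal.ofReal α • ν ≤ (gibbs G).map fun p => (φ t (q, p)).1 := by
  have hm := hF.pos
  set l := Real.exp L with hl
  have hl0 : 0 < l := Real.exp_pos _
  set c := m / 2 * t with hc
  have hc0 : 0 < c := by positivity
  have hcont : Continuous (φ t) := hφ.continuous_apply (lipschitz_field hF hG) t
  have hmono := inner_position_sub_ge hF hG hφ ht.le ht1 h₁ h₂
  have hlip : ∀ q p₁ p₂, ‖(φ t (q, p₁)).1 - (φ t (q, p₂)).1‖ ≤ l * ‖p₁ - p₂‖ := by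
    intro q p₁ p₂
    have := dist_le_exp hF hG hφ ht.le ht1 (q, p₁) (q, p₂)
    rw [Prod.dist_eq (x := (q, p₁)), dist_self, max_eq_right dist_nonneg, dist_eq_norm p₁] at this
    rw [← dist_eq_norm]
    exact (le_max_left _ _).trans this
  -- By strong monotonicity every momentum that carries some `q` with `‖q‖ ≤ r` into the unit ball
  -- has norm at most `M`. On that ball of momenta the density is at least `gm`.
  set M := (1 + ‖(φ t (0, 0)).1‖ + l * |r|) / c with hM
  obtain ⟨x₀, -, hx₀⟩ := (isCompact_closedBall (0 : E) (max M 0)).exists_isMinOn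
    ⟨0, by simp⟩ (f := fun p => Real.exp (-G p))
    (by have := hG.continuous; fun_prop)
  set gm := Real.exp (-G x₀) with hgm
  have hgm0 : 0 < gm := Real.exp_pos _
  set B : Set E := Metric.ball 0 1 with hB
  have hB0 : volume B ≠ 0 := (Metric.measure_ball_pos _ _ one_pos).ne'
  have hBtop : volume B ≠ ⊤ := measure_ball_lt_top.ne
  set n := Module.finrank ℝ E with hn
  set α := gm * (volume B).toReal / l ^ n with hα
  have hα0 : 0 < α := by
    have := ENNReal.toReal_pos hB0 hBtop
    positivity
  refine ⟨α, hα0, (volume B)⁻¹ • volume.restrict B, ⟨?_⟩, fun q hq => ?_⟩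
  · simp [ENNReal.inv_mul_cancel hB0 hBtop]
  have hmeas : Measurable fun p => (φ t (q, p)).1 := by fun_prop
  refine Measure.le_iff.2 fun A hA => ?_
  rw [Measure.map_apply hmeas hA]
  set S : Set E := (fun p => (φ t (q, p)).1) ⁻¹' A ∩ Metric.closedBall 0 (max M 0) with hS
  have hSm : MeasurableSet S := (hmeas hA).inter Metric.isClosed_closedBall.measurableSet
  have hcov : A ∩ B ⊆ (fun p => (φ t (q, p)).1) '' S := by
    rintro y ⟨hyA, hyB⟩
    obtain ⟨p, hp⟩ := surjective_of_strongly_monotone hc0 hl0 (hmono q) (hlip q) y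
    simp only at hp
    refine ⟨p, ⟨by simpa [hp] using hyA, ?_⟩, hp⟩
    rw [mem_closedBall_zero_iff]
    refine le_trans ?_ (le_max_left _ _)
    rw [hM, le_div_iff₀ hc0]
    have e1 := hmono q p 0
    rw [hp, sub_zero] at e1
    have e2 := e1.trans (real_inner_le_norm _ _)
    have e3 : ‖y - (φ t (q, 0)).1‖ ≤ 1 + ‖(φ t (0, 0)).1‖ + l * |r| := by
      have f1 : ‖y‖ < 1 := by simpa [hB] using hyB
      have f2 : ‖(φ t (q, 0)).1 - (φ t (0, 0)).1‖ ≤ l * |r| := by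
        have := dist_le_exp hF hG hφ ht.le ht1 (q, 0) (0, 0)
        rw [Prod.dist_eq (x := (q, (0 : E))), dist_self, max_eq_left dist_nonneg,
          dist_zero_right q] at this
        rw [← dist_eq_norm]
        refine (le_max_left _ _).trans (this.trans ?_)
        gcongr
        exact hq.trans (le_abs_self r)
      have f3 : y - (φ t (q, 0)).1 = y - (φ t (0, 0)).1 - ((φ t (q, 0)).1 - (φ t (0, 0)).1) := by
        abel
      rw [f3]
      have := norm_sub_le (y - (φ t (0, 0)).1) ((φ t (q, 0)).1 - (φ t (0, 0)).1)
      have := norm_sub_le y (φ t (0, 0)).1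
      linarith
    refine le_trans ?_ e3
    rcases (norm_nonneg p).eq_or_lt with h0 | h0
    · rw [← h0, zero_mul]; exact norm_nonneg _
    · have : ‖p‖ * (‖p‖ * c) ≤ ‖p‖ * ‖y - (φ t (q, 0)).1‖ := by
        rw [hc]; linarith
      exact le_of_mul_le_mul_left this h0
  have hK : LipschitzWith l.toNNReal fun p => (φ t (q, p)).1 :=
    LipschitzWith.of_dist_le_mul fun p₁ p₂ => by
      rw [dist_eq_norm, dist_eq_norm, Real.coe_toNNReal _ hl0.le]
      exact hlip q p₁ p₂
  have hvol := volume_le_of_subset_image hK hcov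
  have hlow : ENNReal.ofReal gm * volume S ≤ gibbs G ((fun p => (φ t (q, p)).1) ⁻¹' A) := by
    refine le_trans ?_ (measure_mono (Set.inter_subset_left : S ⊆ _))
    rw [gibbs, withDensity_apply _ hSm, ← setLIntegral_const]
    refine setLIntegral_mono' hSm fun p hp => ENNReal.ofReal_le_ofReal ?_
    exact hx₀ hp.2
  refine le_trans ?_ hlow
  rw [Measure.smul_apply, Measure.smul_apply, Measure.restrict_apply hA, smul_eq_mul, smul_eq_mul]
  have e : ENNReal.ofReal α = ENNReal.ofReal gm * volume B * (ENNReal.ofReal l ^ n)⁻¹ := by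
    rw [hα, ENNReal.ofReal_div_of_pos (by positivity), ENNReal.ofReal_mul hgm0.le,
      ENNReal.ofReal_toReal hBtop, ENNReal.ofReal_pow hl0.le, div_eq_mul_inv]
  have hl1 : ENNReal.ofReal l ^ n ≠ 0 := pow_ne_zero _ (by simpa using hl0)
  have hl2 : ENNReal.ofReal l ^ n ≠ ⊤ := ENNReal.pow_ne_top ENNReal.ofReal_ne_top
  calc ENNReal.ofReal α * ((volume B)⁻¹ * volume (A ∩ B))
      ≤ ENNReal.ofReal gm * volume B * (ENNReal.ofReal l ^ n)⁻¹ *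
        ((volume B)⁻¹ * (ENNReal.ofReal l ^ n * volume S)) := by
        rw [e]; gcongr; exact hvol
    _ = ENNReal.ofReal gm * volume S * (volume B * (volume B)⁻¹) *
        ((ENNReal.ofReal l ^ n)⁻¹ * (ENNReal.ofReal l ^ n)) := by ring
    _ = ENNReal.ofReal gm * volume S := by
        rw [ENNReal.mul_inv_cancel hB0 hBtop, ENNReal.inv_mul_cancel hl1 hl2, mul_one, mul_one]

/-- The Hamiltonian flow preserves the product Gibbs measure. -/
theorem IsFlow.measurePreserving_gibbs (hF : IsRegularPotential F m L)
    (hG : IsRegularPotential G m L) (hφ : IsFlow (hamiltonianField (gradient F) (gradient G)) φ)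
    {t : ℝ} (ht : 0 ≤ t) :
    MeasurePreserving (φ t) ((gibbs F).prod (gibbs G)) ((gibbs F).prod (gibbs G)) := by
  have hmp := hφ.measurePreserving hF.lipschitzWith hG.lipschitzWith ht
  have hFm := hF.continuous.measurable
  have hGm := hG.continuous.measurable
  have hprod : (gibbs F).prod (gibbs G) = (volume : Measure (E × E)).withDensity
      fun z => ENNReal.ofReal (Real.exp (-(F z.1 + G z.2))) := by
    rw [gibbs, gibbs, prod_withDensity (by fun_prop) (by fun_prop)]
    congr 1
    ext z
    rw [← ENNReal.ofReal_mul (Real.exp_pos _).le, ← Real.exp_add, neg_add]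
  refine ⟨hmp.measurable, ?_⟩
  ext A hA
  rw [Measure.map_apply hmp.measurable hA, hprod, withDensity_apply _ (hmp.measurable hA),
    -- Liouville's theorem moves the volume; the density is a function of the conserved energy.
    withDensity_apply _ hA, ← hmp.setLIntegral_comp_preimage hA (by fun_prop)]
  refine setLIntegral_congr_fun (hmp.measurable hA) fun z _ => ?_
  simp only [energy_eq hF hG hφ t z]

/-- Contraction of the averaging operator of a Hamiltonian flow at a short time at which it is
self-adjoint. -/
theorem IsFlow.exists_eLpNorm_avg_sub_mean_le (hF : IsRegularPotential F m L)
    (hG : IsRegularPotential G m L) (hφ : IsFlow (hamiltonianField (gradient F) (gradient G)) φ)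
    [IsProbabilityMeasure (gibbs G)] {t : ℝ} (ht : 0 < t) (ht1 : t ≤ 1)
    (h₁ : L * Real.exp L * t ≤ 1 / 8) (h₂ : (L * Real.exp L) ^ 2 * t ≤ m / 8)
    (hadj : ∀ u : E → ℝ, Measurable u → (∃ M, ∀ x, |u x| ≤ M) →
      avg (fun z => (φ (-t) z).1) (gibbs G) u =ᵐ[gibbs F] avg (fun z => (φ t z).1) (gibbs G) u) :
    MeasurePreserving (fun z => (φ t z).1) ((gibbs F).prod (gibbs G)) (gibbs F) ∧
    ∃ ρ : ℝ, 0 < ρ ∧ ρ < 1 ∧ ∀ u : E → ℝ, MemLp u 2 (gibbs F) →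
      eLpNorm (fun x => avg (fun z => (φ t z).1) (gibbs G) u x -
          (∫ x, u x ∂gibbs F) / (gibbs F).real Set.univ) 2 (gibbs F) ≤
        ENNReal.ofReal ρ *
          eLpNorm (fun x => u x - (∫ x, u x ∂gibbs F) / (gibbs F).real Set.univ) 2 (gibbs F) := by
  have := hF.isFiniteMeasure_gibbs
  have hm := hF.pos
  have hv := lipschitz_field hF hG
  have hmp := hφ.measurePreserving_gibbs hF hG ht.le
  have hQ : MeasurePreserving (fun z => (φ t z).1) ((gibbs F).prod (gibbs G)) (gibbs F) :=
    measurePreserving_fst.comp hmp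
  refine ⟨hQ, ?_⟩
  have hback : Measurable (φ (-t)) := (hφ.continuous_apply hv (-t)).measurable
  obtain ⟨CF, hCF0, hCF⟩ := hF.exists_quadratic_bounds
  obtain ⟨CG, hCG0, hCG⟩ := hG.exists_quadratic_bounds
  set C := max CF CG with hC
  have hC0 : 0 ≤ C := hCF0.trans (le_max_left _ _)
  have hFC : ∀ x, m / 4 * ‖x‖ ^ 2 - C ≤ F x ∧ F x ≤ C * (1 + ‖x‖ ^ 2) := fun x =>
    ⟨by linarith [(hCF x).1, le_max_left CF CG],
      (hCF x).2.trans (by gcongr; exact le_max_left _ _)⟩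
  have hGC : ∀ x, m / 4 * ‖x‖ ^ 2 - C ≤ G x ∧ G x ≤ C * (1 + ‖x‖ ^ 2) := fun x =>
    ⟨by linarith [(hCG x).1, le_max_right CF CG],
      (hCG x).2.trans (by gcongr; exact le_max_right _ _)⟩
  obtain ⟨γ, D, hγ0, hγ1, hD0, hdrift⟩ := exists_drift hF hG hφ ht ht1 h₂ hC0 hFC hGC
  have hV0 : ∀ x, 0 ≤ F x + C := fun x => by
    have : 0 ≤ m / 4 * ‖x‖ ^ 2 := by positivity
    linarith [(hFC x).1]
  have hVm : Measurable fun x => F x + C := hF.continuous.measurable.add_const C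
  have hmaj : ∀ q, Integrable (fun p : E => γ * (F q + C) + D * (1 + ‖p‖ ^ 2)) (gibbs G) :=
    fun q => (integrable_const _).add (hG.integrable_quadratic.const_mul D)
  have hVint : ∀ q, Integrable (fun p => F (φ t (q, p)).1 + C) (gibbs G) := fun q =>
    (hmaj q).mono' ((hVm.comp (hQ.measurable.comp measurable_prodMk_left)).aestronglyMeasurable)
      (Filter.Eventually.of_forall fun p => by
        rw [Real.norm_of_nonneg (hV0 _)]; exact hdrift q p)
  refine HMC.exists_eLpNorm_avg_sub_mean_le hQ ?_ hVm hV0 ?_ hVint hγ0 hγ1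
    (K := D * ∫ p, (1 + ‖p‖ ^ 2) ∂gibbs G) (by positivity) ?_ ?_
  · intro u w hu hw hub hwb
    -- Both pairings are integrals over phase space. The invariant change of variables `φ t`
    -- exchanges the forward and the backward operator, and `hadj` identifies the two.
    have key : ∀ u w : E → ℝ, Measurable u → Measurable w → (∃ M, ∀ x, |u x| ≤ M) →
        (∃ M, ∀ x, |w x| ≤ M) → ∀ T : E × E → E × E, Measurable T →
        Integrable (fun z => u (T z).1 * w z.1) ((gibbs F).prod (gibbs G)) ∧
        ∫ x, avg (fun z => (T z).1) (gibbs G) u x * w x ∂gibbs F =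
          ∫ z, u (T z).1 * w z.1 ∂((gibbs F).prod (gibbs G)) := by
      rintro u w hu hw ⟨Mu, hMu⟩ ⟨Mw, hMw⟩ T hT
      have hi : Integrable (fun z => u (T z).1 * w z.1) ((gibbs F).prod (gibbs G)) := by
        refine (integrable_const (Mu * Mw)).mono' (by fun_prop)
          (Filter.Eventually.of_forall fun z => ?_)
        rw [Real.norm_eq_abs, abs_mul]
        exact mul_le_mul (hMu _) (hMw _) (abs_nonneg _) ((abs_nonneg _).trans (hMu 0))
      refine ⟨hi, ?_⟩
      rw [integral_prod _ hi]
      simp only [avg, integral_mul_const]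
    rw [(key u w hu hw hub hwb _ hmp.measurable).2]
    have e1 : ∫ x, u x * avg (fun z => (φ t z).1) (gibbs G) w x ∂gibbs F =
        ∫ x, avg (fun z => (φ (-t) z).1) (gibbs G) w x * u x ∂gibbs F := by
      refine integral_congr_ae ?_
      filter_upwards [hadj w hw hwb] with x hx
      rw [hx, mul_comm]
    obtain ⟨hi, e2⟩ := key w u hw hu hwb hub _ hback
    rw [e1, e2]
    have e3 := integral_map (μ := (gibbs F).prod (gibbs G)) (φ := φ t) hmp.measurable.aemeasurable
      (f := fun z => w (φ (-t) z).1 * u z.1) (by rw [hmp.map_eq]; exact hi.1)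
    rw [hmp.map_eq] at e3
    rw [e3]
    refine integral_congr_ae (Filter.Eventually.of_forall fun z => ?_)
    simp only [hφ.neg_apply hv, mul_comm]
  · refine (hF.integrable_quadratic.const_mul (2 * C)).mono' hVm.aestronglyMeasurable
      (Filter.Eventually.of_forall fun x => ?_)
    rw [Real.norm_of_nonneg (hV0 x)]
    have := mul_nonneg hC0 (sq_nonneg ‖x‖)
    linarith [(hFC x).2]
  · intro q
    have h1 := integral_mono (hVint q) (hmaj q) (fun p => hdrift q p)
    rw [integral_add (integrable_const _) (hG.integrable_quadratic.const_mul D),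
      integral_const, probReal_univ, one_smul, integral_const_mul] at h1
    exact h1
  · intro R
    -- `F q + C ≤ R` forces `‖q‖² ≤ 4 R / m`, and `‖q‖ ≤ ‖q‖² + 1`.
    obtain ⟨α, hα, ν, hν, hmin⟩ := hφ.exists_minorization hF hG ht ht1 h₁ h₂ (4 * R / m + 1)
    refine ⟨α, hα, ν, hν, fun q hq => hmin q ?_⟩
    have h1 : m / 4 * ‖q‖ ^ 2 ≤ R := by linarith [(hFC q).1]
    have h2 : ‖q‖ ^ 2 ≤ 4 * R / m := by
      rw [le_div_iff₀ hm]; linarith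
    nlinarith [sq_nonneg (‖q‖ - 1), norm_nonneg q]

end Gibbs
end HMC

namespace HMC

/-! ### Translation between the weighted space and the Gibbs measure -/

section Centering

variable {X : Type*} [MeasurableSpace X] {π : Measure X} [IsFiniteMeasure π]

/-- The variance is at most the second moment. As the case `n = 0` of the final estimate it lets the
bound hold without a prefactor. -/
lemma eLpNorm_sub_mean_le {u : X → ℝ} (hu : MemLp u 2 π) :
    eLpNorm (fun x => u x - (∫ x, u x ∂π) / π.real Set.univ) 2 π ≤ eLpNorm u 2 π := by
  rcases eq_or_ne π 0 with rfl | hπ0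
  · simp
  have hne : 0 < π.real Set.univ := by
    rw [measureReal_def]
    exact ENNReal.toReal_pos (by simpa using hπ0) (measure_ne_top _ _)
  set c := (∫ x, u x ∂π) / π.real Set.univ with hc
  have hui := hu.integrable (by norm_num : (1 : ENNReal) ≤ 2)
  have hsub : MemLp (fun x => u x - c) 2 π := hu.sub (memLp_const c)
  rw [MemLp.eLpNorm_eq_integral_rpow_norm (by simp) (by simp) hu,
    MemLp.eLpNorm_eq_integral_rpow_norm (by simp) (by simp) hsub]
  refine ENNReal.ofReal_le_ofReal (Real.rpow_le_rpow ?_ ?_ (by positivity))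
  · exact integral_nonneg fun x => by positivity
  simp only [ENNReal.toReal_ofNat, Real.rpow_ofNat, Real.norm_eq_abs, sq_abs]
  have hlin : Integrable (fun x => 2 * c * u x - c ^ 2) π :=
    (hui.const_mul _).sub (integrable_const _)
  have e : ∫ x, (u x - c) ^ 2 ∂π = ∫ x, u x ^ 2 ∂π - ∫ x, (2 * c * u x - c ^ 2) ∂π := by
    rw [← integral_sub hu.integrable_sq hlin]
    exact integral_congr_ae (Filter.Eventually.of_forall fun x => by simp only; ring)
  rw [e, integral_sub (hui.const_mul _) (integrable_const _), integral_const_mul, integral_const,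
    smul_eq_mul]
  have : ∫ x, u x ∂π = c * π.real Set.univ := by rw [hc, div_mul_cancel₀ _ hne.ne']
  rw [this]
  nlinarith [mul_nonneg hne.le (sq_nonneg c)]

end Centering

section Iterate

variable {X Y : Type*} [MeasurableSpace X] [MeasurableSpace Y] {Q : X × Y → X} {μ : Measure Y}
  [IsProbabilityMeasure μ] {π : Measure X} [IsFiniteMeasure π]

lemma eLpNorm_iterate_avg_sub_mean_le (hπ : MeasurePreserving Q (π.prod μ) π) {ρ : ℝ}
    (hρ : 0 < ρ) (hcon : ∀ u : X → ℝ, MemLp u 2 π →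
      eLpNorm (fun x => avg Q μ u x - (∫ x, u x ∂π) / π.real Set.univ) 2 π ≤
        ENNReal.ofReal ρ * eLpNorm (fun x => u x - (∫ x, u x ∂π) / π.real Set.univ) 2 π)
    {u : X → ℝ} (hu : MemLp u 2 π) (n : ℕ) :
    MemLp ((avg Q μ)^[n] u) 2 π ∧
      eLpNorm (fun x => (avg Q μ)^[n] u x - (∫ x, u x ∂π) / π.real Set.univ) 2 π ≤
        ENNReal.ofReal (ρ ^ n) * eLpNorm u 2 π := by
  have hint : ∀ n, MemLp ((avg Q μ)^[n] u) 2 π ∧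
      ∫ x, (avg Q μ)^[n] u x ∂π = ∫ x, u x ∂π := by
    intro n
    induction n with
    | zero => exact ⟨hu, rfl⟩
    | succ n ih =>
      rw [Function.iterate_succ_apply']
      exact ⟨(eLpNorm_avg_le hπ ih.1).1,
        (integral_avg hπ (ih.1.integrable (by norm_num))).2.2.trans ih.2⟩
  refine ⟨(hint n).1, ?_⟩
  induction n with
  | zero => simpa using eLpNorm_sub_mean_le hu
  | succ n ih =>
    have h1 := hcon _ (hint n).1
    rw [(hint n).2] at h1
    rw [Function.iterate_succ_apply']
    refine h1.trans ?_
    rw [pow_succ', ENNReal.ofReal_mul hρ.le, mul_assoc]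
    gcongr

end Iterate

/-! ### Conjugation by `f` and identification of the Hamiltonian flow. -/

section Weighted

variable {d : ℕ} {f g : EuclideanSpace ℝ (Fin d) → ℝ}

lemma exp_neg_neg_log {f : EuclideanSpace ℝ (Fin d) → ℝ} (hf : ∀ x, 0 < f x)
    (x : EuclideanSpace ℝ (Fin d)) : Real.exp (-(-Real.log (f x))) = f x := by
  rw [neg_neg, Real.exp_log (hf x)]

/-- The densities match: `(f u)² / f = u² f`. -/
lemma eLpNorm_mul_weight (hf : ∀ x, 0 < f x) (hfm : Measurable f)
    (u : EuclideanSpace ℝ (Fin d) → ℝ) :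
    eLpNorm (fun x => f x * u x) 2 (weight f) =
      eLpNorm u 2 (gibbs fun x => -Real.log (f x)) := by
  rw [eLpNorm_eq_lintegral_rpow_enorm_toReal (by simp) (by simp),
    eLpNorm_eq_lintegral_rpow_enorm_toReal (by simp) (by simp), weight, gibbs,
    lintegral_withDensity_eq_lintegral_mul_non_measurable _ (by fun_prop) (by simp),
    lintegral_withDensity_eq_lintegral_mul_non_measurable _ (by fun_prop) (by simp)]
  congr 1
  refine lintegral_congr fun x => ?_
  have h := hf x
  simp only [Pi.mul_apply, exp_neg_neg_log hf, ENNReal.toReal_ofNat, ENNReal.rpow_ofNat, enorm_mul,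
    Real.enorm_eq_ofReal h.le, mul_pow]
  rw [← mul_assoc]
  congr 1
  rw [← ENNReal.ofReal_pow h.le, ← ENNReal.ofReal_mul (by positivity)]
  congr 1
  field_simp

lemma memLp_mul_weight_iff (hf : ∀ x, 0 < f x) (hfm : Measurable f)
    {u : EuclideanSpace ℝ (Fin d) → ℝ} :
    MemLp (fun x => f x * u x) 2 (weight f) ↔ MemLp u 2 (gibbs fun x => -Real.log (f x)) := by
  have hlog : Measurable fun x => -Real.log (f x) := by fun_prop
  have h1 : weight f ≪ volume := withDensity_absolutelyContinuous _ _
  have h2 : volume ≪ weight f := withDensity_absolutelyContinuous' (by fun_prop)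
    (Filter.Eventually.of_forall fun x => by simpa using hf x)
  have h3 := gibbs_absolutelyContinuous fun x => -Real.log (f x)
  have h4 := absolutelyContinuous_gibbs hlog
  unfold MemLp
  rw [eLpNorm_mul_weight hf hfm]
  refine and_congr_left fun _ => ⟨fun h => ?_, fun h => ?_⟩
  · have h5 := ((h.mono_ac h2).mul (hfm.inv.aestronglyMeasurable)).mono_ac h3
    refine h5.congr (Filter.Eventually.of_forall fun x => ?_)
    have := (hf x).ne'
    simp only [Pi.mul_apply, Pi.inv_apply]
    field_simp
  · exact (hfm.aestronglyMeasurable.mul (h.mono_ac h4)).mono_ac h1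

/-- Energy conservation replaces `f(Q) g(P)` by `f(q) g(p)`, so conjugation by `f` turns the
operator into a Markov average. -/
lemma hmcOperator_mul (hf : ∀ x, 0 < f x) (hg : ∀ x, 0 < g x) (hgm : Measurable g)
    {H : EuclideanSpace ℝ (Fin d) × EuclideanSpace ℝ (Fin d) →
      EuclideanSpace ℝ (Fin d) × EuclideanSpace ℝ (Fin d)}
    (hH : ∀ z, -Real.log (f (H z).1) + -Real.log (g (H z).2) =
      -Real.log (f z.1) + -Real.log (g z.2)) (u : EuclideanSpace ℝ (Fin d) → ℝ)
    (q : EuclideanSpace ℝ (Fin d)) :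
    (∀ p, f (H (q, p)).1 * u (H (q, p)).1 * g (H (q, p)).2 =
      f q * (u (H (q, p)).1 * Real.exp (-(-Real.log (g p))))) ∧
    hmcOperator g H (fun x => f x * u x) q =
      f q * avg (fun z => (H z).1) (gibbs fun x => -Real.log (g x)) u q := by
  have key : ∀ p, f (H (q, p)).1 * u (H (q, p)).1 * g (H (q, p)).2 =
      f q * (u (H (q, p)).1 * Real.exp (-(-Real.log (g p)))) := by
    intro p
    have h1 := congrArg (fun x => Real.exp (-x)) (hH (q, p))
    simp only [neg_add, Real.exp_add] at h1
    rw [exp_neg_neg_log hf, exp_neg_neg_log hg, exp_neg_neg_log hf, exp_neg_neg_log hg] at h1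
    rw [exp_neg_neg_log hg]
    linear_combination u (H (q, p)).1 * h1
  refine ⟨key, ?_⟩
  have hlog : Measurable fun x => -Real.log (g x) := by fun_prop
  unfold hmcOperator avg
  rw [integral_gibbs hlog, ← integral_const_mul]
  exact integral_congr_ae (Filter.Eventually.of_forall key)

lemma gradient_hamiltonian_snd (hf : ∀ x, 0 < f x) (hg : ∀ x, 0 < g x)
    (q p : EuclideanSpace ℝ (Fin d)) :
    gradient (fun p => hamiltonian f g q p) p = gradient (fun x => -Real.log (g x)) p := by
  have : (fun p => hamiltonian f g q p) = fun p => -Real.log (f q) + -Real.log (g p) := by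
    ext p
    rw [hamiltonian, Real.log_mul (hf q).ne' (hg p).ne', neg_add]
  rw [this]
  simp only [gradient, fderiv_const_add]

lemma gradient_hamiltonian_fst (hf : ∀ x, 0 < f x) (hg : ∀ x, 0 < g x)
    (q p : EuclideanSpace ℝ (Fin d)) :
    gradient (fun q => hamiltonian f g q p) q = gradient (fun x => -Real.log (f x)) q := by
  have : (fun q => hamiltonian f g q p) = fun q => -Real.log (f q) + -Real.log (g p) := by
    ext q
    rw [hamiltonian, Real.log_mul (hf q).ne' (hg p).ne', neg_add]
  rw [this]
  simp only [gradient, fderiv_add_const]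

lemma isHamiltonianTrajectory_iff (hf : ∀ x, 0 < f x) (hg : ∀ x, 0 < g x)
    {γ : ℝ → EuclideanSpace ℝ (Fin d) × EuclideanSpace ℝ (Fin d)} :
    IsHamiltonianTrajectory f g γ ↔ ∀ s, HasDerivAt γ
      (hamiltonianField (gradient fun x => -Real.log (f x)) (gradient fun x => -Real.log (g x))
        (γ s)) s := by
  refine forall_congr' fun s => ?_
  rw [gradient_hamiltonian_snd hf hg, gradient_hamiltonian_fst hf hg]
  constructor
  · rintro ⟨h1, h2⟩
    exact h1.prodMk h2
  · intro h
    have h1 := hasFDerivAt_fst.comp_hasDerivAt s h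
    have h2 := hasFDerivAt_snd.comp_hasDerivAt s h
    exact ⟨h1, h2⟩

/-- A trajectory through each point exists, so the chosen one is a genuine trajectory, and
uniqueness identifies it with the flow. -/
lemma hamiltonianFlow_eq (hf : ∀ x, 0 < f x) (hg : ∀ x, 0 < g x) {m L : ℝ}
    (hF : IsRegularPotential (fun x => -Real.log (f x)) m L)
    (hG : IsRegularPotential (fun x => -Real.log (g x)) m L)
    {φ : ℝ → EuclideanSpace ℝ (Fin d) × EuclideanSpace ℝ (Fin d) →
      EuclideanSpace ℝ (Fin d) × EuclideanSpace ℝ (Fin d)}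
    (hφ : IsFlow (hamiltonianField (gradient fun x => -Real.log (f x))
      (gradient fun x => -Real.log (g x))) φ) (t : ℝ) :
    hamiltonianFlow f g t = φ t := by
  ext1 z
  have hex : ∃ γ, IsHamiltonianTrajectory f g γ ∧ γ 0 = z :=
    ⟨fun s => φ s z, (isHamiltonianTrajectory_iff hf hg).2 (hφ.hasDerivAt z), hφ.zero z⟩
  have hspec := Classical.epsilon_spec hex
  have := hφ.eq_of_hasDerivAt (IsFlow.lipschitz_field hF hG)
    ((isHamiltonianTrajectory_iff hf hg).1 hspec.1) t
  rw [hspec.2] at this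
  exact this

end Weighted

end HMC

/-! ### The main theorem. -/

theorem mainTheorem2 (d : ℕ) (f g : EuclideanSpace ℝ (Fin d) → ℝ)
    (hf : HMC.UniformlyStronglyLogConcave f) (hg : HMC.UniformlyStronglyLogConcave g)
    (hg1 : ∫ p, g p = 1) :
    Integrable f ∧
    ∃ t₀ : ℝ, 0 < t₀ ∧ ∀ t : ℝ, 0 < t → t < t₀ →
      HMC.IsSelfAdjointHMC f g (HMC.hamiltonianFlow f g t) →
      ∃ ρ : ℝ, 0 < ρ ∧ ρ < 1 ∧
        ∀ h : EuclideanSpace ℝ (Fin d) → ℝ, MemLp h 2 (HMC.weight f) →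
          Integrable h ∧
          ∀ n : ℕ,
            MemLp ((HMC.hmcOperator g (HMC.hamiltonianFlow f g t))^[n] h) 2 (HMC.weight f) ∧
            (∀ᵐ q, Integrable (fun p : EuclideanSpace ℝ (Fin d) =>
              (HMC.hmcOperator g (HMC.hamiltonianFlow f g t))^[n] h
                (HMC.hamiltonianFlow f g t (q, p)).1 *
              g (HMC.hamiltonianFlow f g t (q, p)).2)) ∧
            eLpNorm (fun q => (HMC.hmcOperator g (HMC.hamiltonianFlow f g t))^[n] h q -
                f q * ((∫ x, h x) / ∫ x, f x)) 2 (HMC.weight f) ≤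
              ENNReal.ofReal (ρ ^ n) * eLpNorm h 2 (HMC.weight f) := by
  have hf0 := hf.1
  have hg0 := hg.1
  obtain ⟨m₁, L₁, hF₁⟩ := hf.exists_isRegularPotential
  obtain ⟨m₂, L₂, hG₂⟩ := hg.exists_isRegularPotential
  set F : EuclideanSpace ℝ (Fin d) → ℝ := fun x => -Real.log (f x) with hFdef
  set G : EuclideanSpace ℝ (Fin d) → ℝ := fun x => -Real.log (g x) with hGdef
  set m := min m₁ m₂ with hm
  set L := max L₁ L₂ with hL
  have hm0 : 0 < m := lt_min hF₁.pos hG₂.pos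
  have hF : HMC.IsRegularPotential F m L := hF₁.weaken hm0 (min_le_left _ _) (le_max_left _ _)
  have hG : HMC.IsRegularPotential G m L := hG₂.weaken hm0 (min_le_right _ _) (le_max_right _ _)
  have hL0 : 0 ≤ L := hF.nonneg
  have hexpF : ∀ x, Real.exp (-F x) = f x := HMC.exp_neg_neg_log hf0
  have hexpG : ∀ x, Real.exp (-G x) = g x := HMC.exp_neg_neg_log hg0
  have hFm : Measurable F := hF.continuous.measurable
  have hGm : Measurable G := hG.continuous.measurable
  have hfm : Measurable f := by
    have : f = fun x => Real.exp (-F x) := funext fun x => (hexpF x).symm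
    rw [this]; fun_prop
  have hgm : Measurable g := by
    have : g = fun x => Real.exp (-G x) := funext fun x => (hexpG x).symm
    rw [this]; fun_prop
  have hfi : Integrable f := by simpa only [hexpF] using hF.integrable_exp_neg
  have hgi : Integrable g := by simpa only [hexpG] using hG.integrable_exp_neg
  have := hF.isFiniteMeasure_gibbs
  have hprob : IsProbabilityMeasure (HMC.gibbs G) := by
    refine ⟨?_⟩
    rw [HMC.gibbs, withDensity_apply _ MeasurableSet.univ, Measure.restrict_univ]
    simp only [hexpG]
    rw [← ofReal_integral_eq_lintegral_ofReal hgi (Filter.Eventually.of_forall fun x => (hg0 x).le),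
      hg1, ENNReal.ofReal_one]
  have hv := HMC.IsFlow.lipschitz_field hF hG
  obtain ⟨φ, hφ⟩ := HMC.exists_isFlow hv
  have hflow := HMC.hamiltonianFlow_eq hf0 hg0 hF hG hφ
  refine ⟨hfi, ?_⟩
  set Λ := L * Real.exp L with hΛ
  have hΛ0 : 0 ≤ Λ := by positivity
  -- The entries give `t ≤ 1`, `Λ t ≤ 1 / 8` and `Λ² t ≤ m / 8`; the added `1` avoids division by
  -- zero.
  refine ⟨min 1 (min (1 / (8 * (Λ + 1))) (m / (8 * (Λ ^ 2 + 1)))), by positivity,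
    fun t ht htt hsa => ?_⟩
  have ht1 : t ≤ 1 := htt.le.trans (min_le_left _ _)
  have h₁ : Λ * t ≤ 1 / 8 := by
    have := htt.le.trans ((min_le_right _ _).trans (min_le_left _ _))
    rw [le_div_iff₀ (by positivity)] at this
    linarith
  have h₂ : Λ ^ 2 * t ≤ m / 8 := by
    have := htt.le.trans ((min_le_right _ _).trans (min_le_right _ _))
    rw [le_div_iff₀ (by positivity)] at this
    linarith
  rw [hflow t] at hsa ⊢
  have hop := fun s u q => HMC.hmcOperator_mul hf0 hg0 hgm
    (HMC.IsFlow.energy_eq hF hG hφ s) u q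
  have hinv : Function.invFun (φ t) = φ (-t) := by
    ext1 z
    have hsurj : φ t (Function.invFun (φ t) z) = z :=
      Function.invFun_eq ⟨φ (-t) z, hφ.apply_neg hv t z⟩
    have h1 := hφ.neg_apply hv t (Function.invFun (φ t) z)
    rw [hsurj] at h1
    exact h1.symm
  -- Self-adjointness is tested on `f u` with `u` bounded, and the factor `f` is cancelled.
  have hadj : ∀ u : EuclideanSpace ℝ (Fin d) → ℝ, Measurable u → (∃ M, ∀ x, |u x| ≤ M) →
      HMC.avg (fun z => (φ (-t) z).1) (HMC.gibbs G) u =ᵐ[HMC.gibbs F]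
        HMC.avg (fun z => (φ t z).1) (HMC.gibbs G) u := by
    rintro u hu ⟨M, hM⟩
    have huL : MemLp u 2 (HMC.gibbs F) :=
      MemLp.of_bound hu.aestronglyMeasurable M (Filter.Eventually.of_forall hM)
    have h1 := hsa _ ((HMC.memLp_mul_weight_iff hf0 hfm).2 huL)
    rw [hinv] at h1
    refine (HMC.gibbs_absolutelyContinuous F).ae_le ?_
    filter_upwards [h1] with q hq
    rw [(hop (-t) u q).2, (hop t u q).2] at hq
    exact mul_left_cancel₀ (hf0 q).ne' hq
  obtain ⟨hQ, ρ, hρ0, hρ1, hρ⟩ := hφ.exists_eLpNorm_avg_sub_mean_le hF hG ht ht1 h₁ h₂ hadj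
  refine ⟨ρ, hρ0, hρ1, fun h hh => ?_⟩
  obtain ⟨u, rfl⟩ : ∃ u : EuclideanSpace ℝ (Fin d) → ℝ, h = fun x => f x * u x :=
    ⟨fun x => h x / f x, funext fun x => (mul_div_cancel₀ _ (hf0 x).ne').symm⟩
  have hu : MemLp u 2 (HMC.gibbs F) := (HMC.memLp_mul_weight_iff hf0 hfm).1 hh
  have hui : Integrable u (HMC.gibbs F) := hu.integrable (by norm_num)
  have hiter : ∀ n, (HMC.hmcOperator g (φ t))^[n] (fun x => f x * u x) =
      fun x => f x * (HMC.avg (fun z => (φ t z).1) (HMC.gibbs G))^[n] u x := by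
    intro n
    induction n with
    | zero => rfl
    | succ n ih =>
      rw [Function.iterate_succ_apply', Function.iterate_succ_apply', ih]
      exact funext fun q => (hop t _ q).2
  refine ⟨?_, fun n => ?_⟩
  · have := (HMC.integrable_gibbs_iff hFm).1 hui
    simpa only [hexpF, mul_comm] using this
  obtain ⟨hn1, hn2⟩ := HMC.eLpNorm_iterate_avg_sub_mean_le hQ hρ0 hρ hu n
  rw [hiter n]
  set ψ := (HMC.avg (fun z => (φ t z).1) (HMC.gibbs G))^[n] u
  refine ⟨(HMC.memLp_mul_weight_iff hf0 hfm).2 hn1, ?_, ?_⟩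
  · refine (HMC.absolutelyContinuous_gibbs hFm).ae_le ?_
    filter_upwards [(HMC.integral_avg hQ (hn1.integrable (by norm_num))).2.1] with q hq
    have h1 := ((HMC.integrable_gibbs_iff hGm).1 hq).const_mul (f q)
    exact h1.congr (Filter.Eventually.of_forall fun p => ((hop t ψ q).1 p).symm)
  · have e1 : ∫ x, u x ∂HMC.gibbs F = ∫ x, f x * u x := by
      rw [HMC.integral_gibbs hFm]
      simp only [hexpF, mul_comm]
    have e2 : (HMC.gibbs F).real Set.univ = ∫ x, f x := by
      have := HMC.integral_gibbs hFm fun _ => 1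
      simpa only [integral_const, smul_eq_mul, mul_one, one_mul, hexpF] using this
    rw [e1, e2] at hn2
    rw [HMC.eLpNorm_mul_weight hf0 hfm, ← hFdef]
    refine le_trans (le_of_eq ?_) hn2
    rw [hFdef, ← HMC.eLpNorm_mul_weight hf0 hfm]
    congr 1
    ext q
    ring
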